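/- Let $\mathbb{P}^1=\mathbb{P}^1(\mathbb{C})$ and let $G\subset \mathrm{PSU}(2)\cong \mathrm{SO}(3)\subset \mathrm{PSL}_2(\mathbb{C})$ be a group of rotations isomorphic to $A_4$, $S_4$ or $A_5$, acting diagonally on $\mathbb{P}^1\times\mathbb{P}^1$ by $g\cdot(w,z)=(gw,gz)$. Let $k\ge 0$ be an integer and let $\Sigma\subset\mathbb{P}^1\times\mathbb{P}^1$ be a smooth $G$-invariant curve of bidegree $(k,k)$ (that is, the zero locus of a bihomogeneous polynomial of bidegree $(k,k)$ whose gradient does not vanish at any of its zeros), such that the quotient Riemann surface $\Sigma/G$ is an elliptic curve, i.e. biholomorphic to $\mathbb{C}/\Lambda$ for some lattice $\Lambda$. Let $Z=\mathbb{P}^1\times\mathbb{P}^1\setminus\{(w,z): z=-1/\bar w\}$ be the complement of the antidiagonal. Then: 1. if $G\cong A_4$ and $\Sigma\subset Z$, then $k=3$ or $k=4$; 2. if $G\cong S_4$, then $k=4$; 3. if $G\cong A_5$, then $k=6$. -/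

import Mathlib

open scoped LinearAlgebra.Projectivization Topology

noncomputable section

namespace PlatonicCurves

/-- The complex projective line, with homogeneous coordinates indexed by `Fin 2`. -/
abbrev P1 : Type := ℙ ℂ (Fin 2 → ℂ)

/-- The standard topology of the projective line: the quotient topology from the nonzero vectors. -/
instance : TopologicalSpace P1 :=
  inferInstanceAs (TopologicalSpace (Quotient (projectivizationSetoid ℂ (Fin 2 → ℂ))))

/-- Bihomogeneous polynomials of bidegree `(a, b)` in the homogeneous coordinates
`x = (x₀, x₁)` (left) and `y = (y₀, y₁)` (right) of the two factors. -/
def IsBihomogeneous (f : MvPolynomial (Fin 2 ⊕ Fin 2) ℂ) (a b : ℕ) : Prop :=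
  MvPolynomial.IsWeightedHomogeneous
    (Sum.elim (fun _ => ((1, 0) : ℕ × ℕ)) (fun _ => ((0, 1) : ℕ × ℕ))) f (a, b)

/-- The zero locus of a (bihomogeneous) polynomial in the product of two projective lines. -/
def zeroLocus (f : MvPolynomial (Fin 2 ⊕ Fin 2) ℂ) : Set (P1 × P1) :=
  {p | MvPolynomial.eval (Sum.elim p.1.rep p.2.rep) f = 0}

/-- `S` is a smooth `(k, k)` curve: it is the zero locus of a bihomogeneous polynomial of
bidegree `(k, k)` which has a nonvanishing partial derivative at each of its zeros. -/
def IsSmoothCurve (k : ℕ) (S : Set (P1 × P1)) : Prop :=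
  ∃ f : MvPolynomial (Fin 2 ⊕ Fin 2) ℂ, IsBihomogeneous f k k ∧ S = zeroLocus f ∧
    ∀ x y : Fin 2 → ℂ, x ≠ 0 → y ≠ 0 → MvPolynomial.eval (Sum.elim x y) f = 0 →
      ∃ i, MvPolynomial.eval (Sum.elim x y) (MvPolynomial.pderiv i f) ≠ 0

/-- The group `PSL(2, ℂ)`, acting on `P1`, and diagonally on `P1 × P1`. -/
abbrev PSL2 : Type := Matrix.ProjectiveSpecialLinearGroup (Fin 2) ℂ

/-- The rotations (the copy `PSU(2)` of `SO(3)` in `PSL(2, ℂ)`): classes of unitary matrices. -/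
def IsRotation (g : PSL2) : Prop :=
  ∃ A : Matrix.SpecialLinearGroup (Fin 2) ℂ,
    (A : Matrix (Fin 2) (Fin 2) ℂ) ∈ Matrix.unitaryGroup (Fin 2) ℂ ∧
      (QuotientGroup.mk A : PSL2) = g

/-- The antipodal map `w ↦ -1 / conj w` of the projective line; in homogeneous coordinates
`[x₀ : x₁] ↦ [-conj x₁ : conj x₀]`. -/
def antipode (p : P1) : P1 :=
  Projectivization.mk ℂ ![-star (p.rep 1), star (p.rep 0)] (by
    intro h
    apply p.rep_nonzero
    have h0 := congrFun h 0
    have h1 := congrFun h 1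
    ext i
    fin_cases i
    · simpa using h1
    · simpa using h0)

/-- The twistor space of hyperbolic space: the complement of the antidiagonal. -/
def twistorSpace : Set (P1 × P1) := {p | p.2 ≠ antipode p.1}

/-- The equivalence relation on `S` of lying in the same orbit of `G`. -/
abbrev orbitSetoid (G : Subgroup PSL2) (S : Set (P1 × P1)) : Setoid S :=
  (MulAction.orbitRel G (P1 × P1)).comap Subtype.val

/-- The space of orbits `S / G`, with the quotient topology. -/
abbrev OrbitSpace (G : Subgroup PSL2) (S : Set (P1 × P1)) : Type := Quotient (orbitSetoid G S)

/-- The function `φ` on `S` is holomorphic at `p` (i.e. in a neighbourhood of `p` in `S`): near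
homogeneous coordinates `(x, y)` of `p` it is the restriction of a holomorphic function `F`. -/
def HolomorphicAt (S : Set (P1 × P1)) (φ : S → ℂ) (p : S) : Prop :=
  ∃ (x y : Fin 2 → ℂ) (hx : x ≠ 0) (hy : y ≠ 0),
    (p : P1 × P1) = (Projectivization.mk ℂ x hx, Projectivization.mk ℂ y hy) ∧
    ∃ F : (Fin 2 → ℂ) × (Fin 2 → ℂ) → ℂ, AnalyticAt ℂ F (x, y) ∧
      ∀ᶠ v in 𝓝 (x, y), ∀ (h₁ : v.1 ≠ 0) (h₂ : v.2 ≠ 0)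
        (h : (Projectivization.mk ℂ v.1 h₁, Projectivization.mk ℂ v.2 h₂) ∈ S),
        φ ⟨_, h⟩ = F v

/-- The quotient `S / G` is an elliptic curve: it is isomorphic, as a Riemann surface, to a complex
torus `ℂ / Λ`. The holomorphic functions on the quotient are the functions whose pullback to `S`
is holomorphic, so an isomorphism is a homeomorphism which identifies these with the holomorphic
functions of `ℂ / Λ`. -/
def HasEllipticQuotient (G : Subgroup PSL2) (S : Set (P1 × P1)) : Prop :=
  ∃ (L : PeriodPair) (e : OrbitSpace G S ≃ₜ ℂ ⧸ L.lattice),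
    ∀ (φ : ℂ ⧸ L.lattice → ℂ) (p : S) (t : ℂ), e (Quotient.mk _ p) = L.lattice.mkQ t →
      (AnalyticAt ℂ (fun s => φ (L.lattice.mkQ s)) t ↔
        HolomorphicAt S (fun q => φ (e (Quotient.mk _ q))) p)

end PlatonicCurves

end

open scoped LinearAlgebra.Projectivization Topology

noncomputable section

namespace PlatonicCurves

open Filter Matrix MvPolynomial Equiv

/-! By adjunction, the canonical bundle of a smooth curve of bidegree `(k, k)` is the restriction of
bidegree `(k - 2, k - 2)`: a polynomial `h` of that bidegree gives a holomorphic 1-form, the residue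
of `h / f`. If `f` and `h` are `G`-invariant, the form is invariant and descends to the elliptic
curve, where its quotient by `dt` is a periodic function with removable singularities, hence
constant. So two invariant polynomials of bidegree `(k - 2, k - 2)` are always proportional on the
curve (`exists_linear_relation`), and therefore as polynomials, since a nonzero multiple of `f` has
larger degree.

One such invariant is a power of the equation `diagForm` of the diagonal. If an invariant `P` of
bidegree `(j, j)` with `1 ≤ j ≤ k - 2` does not vanish on the diagonal, then `P` times a power of
`diagForm` is independent of it. Hence `k ≤ j + 1` (`TorusMap.false_of_invariant`). Such a `P` is a
product of symmetric `(1, 1)` forms attached to the rotation axes in one conjugacy class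
(`exists_form_of_axes`); its square is invariant.

A lower bound and congruences come from elsewhere. Degree 0 is impossible for a smooth nonempty
curve, and in degree 1 the curve is a projective line, which has no nonconstant map to a torus. At a
point `(x, x)` fixed by a rotation of order `n`, comparing weights of `f`, or of its differential if
`f` vanishes there, gives `n ∣ k` or `n ∣ k - 1` (`SmoothEquation.dvd_or_dvd`). Together these leave
only the listed degrees.

All this needs `f` to be invariant, not merely semi-invariant. For `A₅` every character is trivial.
For `A₄` the fixed points on the antidiagonal, which the curve avoids, force the character to be 1.
For `S₄` only the sign character has to be excluded, and the antidiagonal fixed points of a rotation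
of order 4 do this. -/

/-- The space of pairs of homogeneous coordinates on the two factors. -/
abbrev Coord : Type := (Fin 2 → ℂ) × (Fin 2 → ℂ)

/-- The standard area form of the plane. -/
def area (x y : Fin 2 → ℂ) : ℂ := x 0 * y 1 - x 1 * y 0

/-- The cone over the curve `f = 0`. -/
def cone (f : Coord → ℂ) : Set Coord := {v | v.1 ≠ 0 ∧ v.2 ≠ 0 ∧ f v = 0}

/-- Homogeneity of the same degree `m` in both variables. -/
def BiScaling (h : Coord → ℂ) (m : ℕ) : Prop :=
  ∀ (a b : ℂ) (v : Coord), h (a • v.1, b • v.2) = a ^ m * b ^ m * h v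

/-- The linear form `w ↦ area x x' * area y w₂ - area y y' * area x w₁`, which is proportional to
the differential of the equation of any curve through `v = (x, y)` tangent to `v' = (x', y')`. -/
def bracket (v v' w : Coord) : ℂ :=
  area v.1 v'.1 * area v.2 w.2 - area v.2 v'.2 * area v.1 w.1

/-! ### Linear algebra and calculus with the area form. -/

lemma area_self (x : Fin 2 → ℂ) : area x x = 0 := by simp only [area]; ring

lemma area_smul_left (a : ℂ) (x y : Fin 2 → ℂ) : area (a • x) y = a * area x y := by
  simp only [area, Pi.smul_apply, smul_eq_mul]; ring

lemma area_smul_right (a : ℂ) (x y : Fin 2 → ℂ) : area x (a • y) = a * area x y := by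
  simp only [area, Pi.smul_apply, smul_eq_mul]; ring

lemma area_add_left (x x' y : Fin 2 → ℂ) : area (x + x') y = area x y + area x' y := by
  simp only [area, Pi.add_apply]; ring

lemma area_swap (x y : Fin 2 → ℂ) : area y x = - area x y := by simp only [area]; ring

lemma area_mulVec (A : Matrix.SpecialLinearGroup (Fin 2) ℂ) (x y : Fin 2 → ℂ) :
    area (A.1 *ᵥ x) (A.1 *ᵥ y) = area x y := by
  have h := A.2
  rw [Matrix.det_fin_two] at h
  simp only [area, Matrix.mulVec, dotProduct, Fin.sum_univ_two]
  linear_combination (x 0 * y 1 - x 1 * y 0) * h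

lemma exists_area_eq_one {x : Fin 2 → ℂ} (hx : x ≠ 0) : ∃ y, area x y = 1 := by
  by_cases h : x 0 = 0
  · have h1 : x 1 ≠ 0 := fun h1 => hx (by ext i; fin_cases i <;> simp [h, h1])
    exact ⟨![-(x 1)⁻¹, 0], by simp [area, h1]⟩
  · exact ⟨![0, (x 0)⁻¹], by simp [area, h]⟩

lemma eq_smul_of_area_eq_zero {x y : Fin 2 → ℂ} (hx : x ≠ 0) (h : area x y = 0) :
    ∃ a : ℂ, y = a • x := by
  by_cases h0 : x 0 = 0
  · have h1 : x 1 ≠ 0 := fun h1 => hx (by ext i; fin_cases i <;> simp [h0, h1])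
    refine ⟨y 1 / x 1, ?_⟩
    ext i; fin_cases i
    · have : x 1 * y 0 = 0 := by simpa [area, h0] using h
      simpa [h0, h1] using this
    · simp [h1]
  · refine ⟨y 0 / x 0, ?_⟩
    ext i; fin_cases i
    · simp [h0]
    · simp only [area] at h
      simp only [Fin.mk_one, Pi.smul_apply, smul_eq_mul]
      field_simp
      linear_combination h

lemma eq_area_smul_add {x z : Fin 2 → ℂ} (hxz : area x z = 1) (w : Fin 2 → ℂ) :
    w = area x w • z + area w z • x := by
  simp only [area] at *
  ext i; fin_cases i
  · simp only [Fin.zero_eta, Pi.add_apply, Pi.smul_apply, smul_eq_mul]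
    linear_combination -(w 0) * hxz
  · simp only [Fin.mk_one, Pi.add_apply, Pi.smul_apply, smul_eq_mul]
    linear_combination -(w 1) * hxz

lemma analyticAt_area {F : Type*} [NormedAddCommGroup F] [NormedSpace ℂ F]
    {a b : F → Fin 2 → ℂ} {s : F} (ha : AnalyticAt ℂ a s) (hb : AnalyticAt ℂ b s) :
    AnalyticAt ℂ (fun r => area (a r) (b r)) s := by
  have ha' := fun i => (ContinuousLinearMap.proj (R := ℂ) (φ := fun _ : Fin 2 => ℂ) i).analyticAt
    (a s) |>.comp ha
  have hb' := fun i => (ContinuousLinearMap.proj (R := ℂ) (φ := fun _ : Fin 2 => ℂ) i).analyticAt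
    (b s) |>.comp hb
  exact ((ha' 0).mul (hb' 1)).sub ((ha' 1).mul (hb' 0))

lemma hasDerivAt_area {a b : ℂ → Fin 2 → ℂ} {a' b' : Fin 2 → ℂ} {s : ℂ} (ha : HasDerivAt a a' s)
    (hb : HasDerivAt b b' s) :
    HasDerivAt (fun r => area (a r) (b r)) (area a' (b s) + area (a s) b') s := by
  rw [hasDerivAt_pi] at ha hb
  refine (((ha 0).mul (hb 1)).sub ((ha 1).mul (hb 0))).congr_deriv ?_
  simp only [area]; ring

/-! ### Smooth bihomogeneous equations: Euler relations and local parametrizations. -/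

lemma fderiv_apply_of_semiinvariant {f : Coord → ℂ} (hf : ∀ v, AnalyticAt ℂ f v)
    (M : Coord →L[ℂ] Coord) (c : ℂ) (h : ∀ v, f (M v) = c * f v) (v w : Coord) :
    fderiv ℂ f (M v) (M w) = c * fderiv ℂ f v w := by
  have h1 : HasFDerivAt (fun v => f (M v)) ((fderiv ℂ f (M v)).comp M) v :=
    (hf (M v)).differentiableAt.hasFDerivAt.comp v M.hasFDerivAt
  have h2 : HasFDerivAt (fun v => f (M v)) (c • fderiv ℂ f v) v := by
    simp only [h]
    exact (hf v).differentiableAt.hasFDerivAt.const_mul c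
  have := congrArg (fun l => l w) (h1.unique h2)
  simpa using this

/-- Multiplication by scalars on the two factors. -/
def scaleL (a b : ℂ) : Coord →L[ℂ] Coord :=
  (a • ContinuousLinearMap.id ℂ (Fin 2 → ℂ)).prodMap (b • ContinuousLinearMap.id ℂ (Fin 2 → ℂ))

/-- The diagonal action of a matrix. -/
def diagL (A : Matrix (Fin 2) (Fin 2) ℂ) : Coord →L[ℂ] Coord :=
  (LinearMap.toContinuousLinearMap A.mulVecLin).prodMap
    (LinearMap.toContinuousLinearMap A.mulVecLin)

@[simp] lemma diagL_apply (A : Matrix (Fin 2) (Fin 2) ℂ) (v : Coord) :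
    diagL A v = (A *ᵥ v.1, A *ᵥ v.2) := rfl

/-- A smooth equation of bidegree `(k, k)`. -/
structure SmoothEquation (f : Coord → ℂ) (k : ℕ) : Prop where
  analytic : ∀ v, AnalyticAt ℂ f v
  scaling : BiScaling f k
  smooth : ∀ v ∈ cone f, fderiv ℂ f v ≠ 0

lemma BiScaling.fderiv_scale {f : Coord → ℂ} {k : ℕ} (hf : ∀ v, AnalyticAt ℂ f v)
    (h : BiScaling f k) (a b : ℂ) (v w : Coord) :
    fderiv ℂ f (a • v.1, b • v.2) (a • w.1, b • w.2) = a ^ k * b ^ k * fderiv ℂ f v w :=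
  fderiv_apply_of_semiinvariant hf (scaleL a b) _ (h a b) v w

namespace SmoothEquation

/-- Euler's relation in the first factor: `f` stays zero when only the first vector is rescaled. -/
lemma fderiv_left {f : Coord → ℂ} {k : ℕ} (hf : SmoothEquation f k) {v : Coord}
    (hv : f v = 0) : fderiv ℂ f v (v.1, 0) = 0 := by
  have h1 : HasDerivAt (fun s : ℂ => v + s • ((v.1, 0) : Coord)) (v.1, 0) 0 := by
    simpa using ((hasDerivAt_id (0 : ℂ)).smul_const ((v.1, 0) : Coord)).const_add v
  have h2 : HasFDerivAt f (fderiv ℂ f v) (v + (0 : ℂ) • ((v.1, 0) : Coord)) := by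
    simpa using (hf.analytic v).differentiableAt.hasFDerivAt
  have h3 := h2.comp_hasDerivAt (0 : ℂ) h1
  have h4 : (f ∘ fun s : ℂ => v + s • ((v.1, 0) : Coord)) = fun _ => 0 := by
    ext s
    have := hf.scaling (1 + s) 1 v
    rw [hv, mul_zero] at this
    rw [← this]
    simp only [Function.comp]
    congr 1
    ext i <;> simp [add_mul]
  rw [h4] at h3
  exact h3.unique (hasDerivAt_const _ _)

lemma fderiv_right {f : Coord → ℂ} {k : ℕ} (hf : SmoothEquation f k) {v : Coord}
    (hv : f v = 0) : fderiv ℂ f v (0, v.2) = 0 := by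
  have h1 : HasDerivAt (fun s : ℂ => v + s • ((0, v.2) : Coord)) (0, v.2) 0 := by
    simpa using ((hasDerivAt_id (0 : ℂ)).smul_const ((0, v.2) : Coord)).const_add v
  have h2 : HasFDerivAt f (fderiv ℂ f v) (v + (0 : ℂ) • ((0, v.2) : Coord)) := by
    simpa using (hf.analytic v).differentiableAt.hasFDerivAt
  have h3 := h2.comp_hasDerivAt (0 : ℂ) h1
  have h4 : (f ∘ fun s : ℂ => v + s • ((0, v.2) : Coord)) = fun _ => 0 := by
    ext s
    have := hf.scaling 1 (1 + s) v
    rw [hv, mul_zero] at this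
    rw [← this]
    simp only [Function.comp]
    congr 1
    ext i <;> simp [add_mul]
  rw [h4] at h3
  exact h3.unique (hasDerivAt_const _ _)

/-- By the two Euler relations the differential at a zero sees each component of `w` only modulo the
base vector, that is, through its area with it. -/
lemma fderiv_eq {f : Coord → ℂ} {k : ℕ} (hf : SmoothEquation f k) {v : Coord}
    (hv : f v = 0) {x y : Fin 2 → ℂ} (hx : area v.1 x = 1)
    (hy : area v.2 y = 1) (w : Coord) :
    fderiv ℂ f v w = area v.1 w.1 * fderiv ℂ f v (x, 0) + area v.2 w.2 * fderiv ℂ f v (0, y) := by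
  have hw : w = area v.1 w.1 • ((x, 0) : Coord) + area w.1 x • ((v.1, 0) : Coord) +
      (area v.2 w.2 • ((0, y) : Coord) + area w.2 y • ((0, v.2) : Coord)) := by
    ext1
    · simpa using eq_area_smul_add hx w.1
    · simpa using eq_area_smul_add hy w.2
  conv_lhs => rw [hw]
  simp only [map_add, map_smul, hf.fderiv_left hv, hf.fderiv_right hv, smul_eq_mul]
  ring

end SmoothEquation

lemma exists_analytic_implicit {f : Coord → ℂ} {v a b : Coord} (hf : AnalyticAt ℂ f v)
    (hb : fderiv ℂ f v b ≠ 0) :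
    ∃ τ : ℂ → ℂ, AnalyticAt ℂ τ 0 ∧ τ 0 = 0 ∧ ∀ᶠ s in 𝓝 (0 : ℂ), f (v + s • a + τ s • b) = f v := by
  let ℓ : ℂ × ℂ →L[ℂ] Coord :=
    (ContinuousLinearMap.fst ℂ ℂ ℂ).smulRight a + (ContinuousLinearMap.snd ℂ ℂ ℂ).smulRight b
  let φ : ℂ × ℂ → ℂ := fun p => f (v + ℓ p)
  have hℓ : v + ℓ (0, 0) = v := by simp [ℓ]
  have hφ : AnalyticAt ℂ φ (0, 0) := by
    refine AnalyticAt.fun_comp (g := f) ?_ (analyticAt_const.add (ℓ.analyticAt _))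
    rwa [hℓ]
  have hd : HasFDerivAt φ ((fderiv ℂ f v).comp ℓ) (0, 0) := by
    refine HasFDerivAt.comp (g := f) (0, 0) ?_ (ℓ.hasFDerivAt.const_add v)
    rw [hℓ]
    exact hf.differentiableAt.hasFDerivAt
  have hc : ContDiffAt ℂ ⊤ φ (0, 0) := hφ.contDiffAt
  have hinv : (fderiv ℂ φ (0, 0) ∘L .inr ℂ ℂ ℂ).IsInvertible := by
    refine ⟨ContinuousLinearEquiv.unitsEquivAut ℂ (Units.mk0 _ hb), ?_⟩
    ext
    simp [hd.fderiv, ℓ]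
  refine ⟨hc.implicitFunction (by simp) hinv, ?_, ?_, ?_⟩
  · exact (hc.contDiffAt_implicitFunction (by simp) hinv).analyticAt
  · exact hc.implicitFunction_apply_self (by simp) hinv
  · filter_upwards [hc.eventually_apply_implicitFunction (by simp) hinv] with s hs
    simpa [φ, ℓ, add_assoc] using hs

/-- A smooth curve has an immersed analytic parametrization near each of its points. -/
lemma SmoothEquation.exists_param {f : Coord → ℂ} {k : ℕ} (hf : SmoothEquation f k) {v : Coord}
    (hv : v ∈ cone f) :
    ∃ γ : ℂ → Coord, AnalyticAt ℂ γ 0 ∧ γ 0 = v ∧ (∀ᶠ s in 𝓝 0, γ s ∈ cone f) ∧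
      ∀ᶠ s in 𝓝 0, area (γ s).1 (deriv γ s).1 ≠ 0 ∨ area (γ s).2 (deriv γ s).2 ≠ 0 := by
  obtain ⟨x, hx⟩ := exists_area_eq_one hv.1
  obtain ⟨y, hy⟩ := exists_area_eq_one hv.2.1
  have key : ∀ a b : Coord, fderiv ℂ f v b ≠ 0 → ∃ τ : ℂ → ℂ, ∃ γ : ℂ → Coord,
      γ = (fun s => v + s • a + τ s • b) ∧
      AnalyticAt ℂ γ 0 ∧ γ 0 = v ∧ (∀ᶠ s in 𝓝 0, γ s ∈ cone f) ∧
      ∀ᶠ s in 𝓝 0, deriv γ s = a + deriv τ s • b := by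
    intro a b hb
    obtain ⟨τ, hτ, hτ0, hτf⟩ := exists_analytic_implicit (a := a) (hf.analytic v) hb
    have hγ : AnalyticAt ℂ (fun s => v + s • a + τ s • b) 0 :=
      (analyticAt_const.add (analyticAt_id.smul analyticAt_const)).add (hτ.smul analyticAt_const)
    have hγ0 : (fun s : ℂ => v + s • a + τ s • b) 0 = v := by simp [hτ0]
    refine ⟨τ, _, rfl, hγ, hγ0, ?_, ?_⟩
    · have hc := hγ.continuousAt
      have h1 : ∀ᶠ s in 𝓝 (0 : ℂ), (v + s • a + τ s • b).1 ≠ 0 :=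
        (continuous_fst.continuousAt.comp hc).eventually_ne (by simpa [hτ0] using hv.1)
      have h2 : ∀ᶠ s in 𝓝 (0 : ℂ), (v + s • a + τ s • b).2 ≠ 0 :=
        (continuous_snd.continuousAt.comp hc).eventually_ne (by simpa [hτ0] using hv.2.1)
      filter_upwards [h1, h2, hτf] with s h1 h2 h3
      exact ⟨h1, h2, h3.trans hv.2.2⟩
    · filter_upwards [hτ.eventually_analyticAt] with s hs
      refine HasDerivAt.deriv ?_
      have h1 : HasDerivAt (fun s : ℂ => v + s • a) a s := by
        simpa using ((hasDerivAt_id s).smul_const a).const_add v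
      exact h1.add (hs.differentiableAt.hasDerivAt.smul_const b)
  -- One of the two transversal partial derivatives is nonzero; that direction is solved for, and
  -- the other one serves as parameter and makes the curve immersed.
  by_cases hb : fderiv ℂ f v (0, y) = 0
  · have ha : fderiv ℂ f v (x, 0) ≠ 0 := by
      intro ha
      refine hf.smooth v hv (ContinuousLinearMap.ext fun w => ?_)
      rw [hf.fderiv_eq hv.2.2 hx hy w, ha, hb]
      simp
    obtain ⟨τ, γ, hγe, hγ, hγ0, hc, hd⟩ := key (0, y) (x, 0) ha
    refine ⟨γ, hγ, hγ0, hc, ?_⟩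
    filter_upwards [hd] with s hs
    right
    rw [hs, hγe]
    simp [area_add_left, hy, area_smul_left, area_self]
  · obtain ⟨τ, γ, hγe, hγ, hγ0, hc, hd⟩ := key (x, 0) (0, y) hb
    refine ⟨γ, hγ, hγ0, hc, ?_⟩
    filter_upwards [hd] with s hs
    left
    rw [hs, hγe]
    simp [area_add_left, hx, area_smul_left, area_self]

/-! ### Maps from the curve to a complex torus. -/

/-- A map from the cone over the curve `f = 0` to the torus `ℂ / Λ`, constant on lines, surjective,
whose fibres lie in the orbits of the finitely many matrices `A i`, and which lifts locally to
holomorphic functions. -/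
structure TorusMap {ι : Type*} (f : Coord → ℂ) (L : PeriodPair)
    (A : ι → Matrix.SpecialLinearGroup (Fin 2) ℂ) (q : Coord → ℂ ⧸ L.lattice) : Prop where
  surj : ∀ t : ℂ, ∃ v ∈ cone f, L.lattice.mkQ t = q v
  scale : ∀ v ∈ cone f, ∀ a : ℂ, a ≠ 0 → q (a • v.1, a • v.2) = q v
  fiber : ∀ v ∈ cone f, ∀ w ∈ cone f, q v = q w →
    ∃ i, area ((A i).1 *ᵥ v.1) w.1 = 0 ∧ area ((A i).1 *ᵥ v.2) w.2 = 0
  lift : ∀ v ∈ cone f, ∀ t : ℂ, L.lattice.mkQ t = q v →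
    ∃ F : Coord → ℂ, AnalyticAt ℂ F v ∧ F v = t ∧
      ∀ᶠ w in 𝓝 v, w ∈ cone f → L.lattice.mkQ (F w) = q w

lemma analyticAt_fst_comp {γ : ℂ → Coord} {s : ℂ} (h : AnalyticAt ℂ γ s) :
    AnalyticAt ℂ (fun r => (γ r).1) s :=
  (ContinuousLinearMap.fst ℂ (Fin 2 → ℂ) (Fin 2 → ℂ)).analyticAt _ |>.comp h

lemma analyticAt_snd_comp {γ : ℂ → Coord} {s : ℂ} (h : AnalyticAt ℂ γ s) :
    AnalyticAt ℂ (fun r => (γ r).2) s :=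
  (ContinuousLinearMap.snd ℂ (Fin 2 → ℂ) (Fin 2 → ℂ)).analyticAt _ |>.comp h

lemma hasDerivAt_fst_comp {γ : ℂ → Coord} {γ' : Coord} {s : ℂ} (h : HasDerivAt γ γ' s) :
    HasDerivAt (fun r => (γ r).1) γ'.1 s :=
  (ContinuousLinearMap.fst ℂ (Fin 2 → ℂ) (Fin 2 → ℂ)).hasFDerivAt.comp_hasDerivAt s h

lemma hasDerivAt_snd_comp {γ : ℂ → Coord} {γ' : Coord} {s : ℂ} (h : HasDerivAt γ γ' s) :
    HasDerivAt (fun r => (γ r).2) γ'.2 s :=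
  (ContinuousLinearMap.snd ℂ (Fin 2 → ℂ) (Fin 2 → ℂ)).hasFDerivAt.comp_hasDerivAt s h

lemma analyticAt_diagL_comp (A : Matrix (Fin 2) (Fin 2) ℂ) {γ : ℂ → Coord} {s : ℂ}
    (h : AnalyticAt ℂ γ s) : AnalyticAt ℂ (fun r => diagL A (γ r)) s :=
  (diagL A).analyticAt _ |>.comp h

section Compare

variable {ι : Type*} [Finite ι] {f : Coord → ℂ} {L : PeriodPair}
  {A : ι → Matrix.SpecialLinearGroup (Fin 2) ℂ} {q : Coord → ℂ ⧸ L.lattice}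

/-- Two curves with the same image in the torus differ by one of the matrices `A i`. -/
lemma TorusMap.exists_eventually_area (hq : TorusMap f L A q) {γ₁ γ₂ : ℂ → Coord} {s₀ : ℂ}
    (h₁ : AnalyticAt ℂ γ₁ s₀) (h₂ : AnalyticAt ℂ γ₂ s₀) (hc₁ : ∀ᶠ s in 𝓝 s₀, γ₁ s ∈ cone f)
    (hc₂ : ∀ᶠ s in 𝓝 s₀, γ₂ s ∈ cone f) (he : ∀ᶠ s in 𝓝 s₀, q (γ₁ s) = q (γ₂ s)) :
    ∃ i, ∀ᶠ s in 𝓝 s₀, area ((A i).1 *ᵥ (γ₁ s).1) (γ₂ s).1 = 0 ∧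
      area ((A i).1 *ᵥ (γ₁ s).2) (γ₂ s).2 = 0 := by
  -- Pigeonhole: each `s` has a matrix that works, and there are finitely many matrices, so one
  -- works for a set of `s` accumulating at `s₀`. The identity theorem then makes it work near `s₀`.
  have h : ∃ i, ∃ᶠ s in 𝓝[≠] s₀, area ((A i).1 *ᵥ (γ₁ s).1) (γ₂ s).1 = 0 ∧
      area ((A i).1 *ᵥ (γ₁ s).2) (γ₂ s).2 = 0 := by
    by_contra hcon
    simp only [not_exists, not_frequently] at hcon
    rw [← eventually_all] at hcon
    have : ∀ᶠ s in 𝓝[≠] s₀, False := by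
      filter_upwards [hcon, hc₁.filter_mono nhdsWithin_le_nhds,
        hc₂.filter_mono nhdsWithin_le_nhds, he.filter_mono nhdsWithin_le_nhds] with s h1 h2 h3 h4
      obtain ⟨i, hi⟩ := hq.fiber _ h2 _ h3 h4
      exact h1 i hi
    exact this.exists.elim fun _ h => h
  obtain ⟨i, hi⟩ := h
  refine ⟨i, ?_⟩
  have ha := analyticAt_diagL_comp (A i).1 h₁
  have h1 := analyticAt_area (analyticAt_fst_comp ha) (analyticAt_fst_comp h₂)
  have h2 := analyticAt_area (analyticAt_snd_comp ha) (analyticAt_snd_comp h₂)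
  have e1 := h1.frequently_zero_iff_eventually_zero.1 (hi.mono fun s hs => hs.1)
  have e2 := h2.frequently_zero_iff_eventually_zero.1 (hi.mono fun s hs => hs.2)
  exact e1.and e2

/-- If `b = c a` along the curve with varying `c`, the term with the derivative of `c` is killed by
the area, so the velocity in the projective line scales by `c ^ 2`. -/
lemma area_deriv_of_eventually_area_eq_zero {a b : ℂ → Fin 2 → ℂ} {a' b' : Fin 2 → ℂ} {s : ℂ}
    (ha : HasDerivAt a a' s) (hb : HasDerivAt b b' s) (h : ∀ᶠ r in 𝓝 s, area (a r) (b r) = 0)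
    {c : ℂ} (hc : b s = c • a s) : area (b s) b' = c ^ 2 * area (a s) a' := by
  have h1 := (hasDerivAt_area ha hb).congr_of_eventuallyEq
    (f₁ := fun _ => 0) (h.mono fun r hr => hr.symm)
  have h2 := h1.unique (hasDerivAt_const s 0)
  rw [hc, area_smul_right] at h2
  rw [hc, area_smul_left]
  rw [area_swap (a s) a'] at h2
  linear_combination c * h2

/-- Along an immersed curve the map to the torus is not constant. -/
lemma TorusMap.not_eventually_const (hq : TorusMap f L A q) {γ : ℂ → Coord} {s₀ : ℂ}
    (h : AnalyticAt ℂ γ s₀) (hc : ∀ᶠ s in 𝓝 s₀, γ s ∈ cone f)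
    (him : area (γ s₀).1 (deriv γ s₀).1 ≠ 0 ∨ area (γ s₀).2 (deriv γ s₀).2 ≠ 0) :
    ¬ ∀ᶠ s in 𝓝 s₀, q (γ s) = q (γ s₀) := by
  intro he
  have hc₀ := hc.self_of_nhds
  obtain ⟨i, hi⟩ := hq.exists_eventually_area (γ₁ := fun _ => γ s₀) analyticAt_const h
    (Eventually.of_forall fun _ => hc₀) hc (he.mono fun s hs => hs.symm)
  have hd := h.differentiableAt.hasDerivAt
  have hne : ∀ x : Fin 2 → ℂ, x ≠ 0 → (A i).1 *ᵥ x ≠ 0 := by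
    intro x hx h0
    obtain ⟨y, hy⟩ := exists_area_eq_one hx
    rw [← area_mulVec (A i), h0] at hy
    simp [area] at hy
  have hi₀ := hi.self_of_nhds
  obtain ⟨a, ha⟩ := eq_smul_of_area_eq_zero (hne _ hc₀.1) hi₀.1
  obtain ⟨b, hb⟩ := eq_smul_of_area_eq_zero (hne _ hc₀.2.1) hi₀.2
  have h1 := area_deriv_of_eventually_area_eq_zero (hasDerivAt_const s₀ ((A i).1 *ᵥ (γ s₀).1))
    (hasDerivAt_fst_comp hd) (hi.mono fun s hs => hs.1) ha
  have h2 := area_deriv_of_eventually_area_eq_zero (hasDerivAt_const s₀ ((A i).1 *ᵥ (γ s₀).2))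
    (hasDerivAt_snd_comp hd) (hi.mono fun s hs => hs.2) hb
  simp only [area, Pi.zero_apply, mul_zero, sub_zero] at h1 h2
  rcases him with him | him
  · exact him h1
  · exact him h2

end Compare

/-! ### Residue forms along parametrized curves. -/

/-- The function `c` is the ratio of the form defined by `h` on the curve `f = 0` and the
differential of the parameter of the curve `γ`, at `s`. -/
def IsRatio (f h : Coord → ℂ) (v v' : Coord) (c : ℂ) : Prop :=
  ∀ w, c * fderiv ℂ f v w = h v * bracket v v' w

lemma IsRatio.unique {f h : Coord → ℂ} {v v' : Coord} {c c' : ℂ} (hf : fderiv ℂ f v ≠ 0)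
    (hc : IsRatio f h v v' c) (hc' : IsRatio f h v v' c') : c = c' := by
  obtain ⟨w, hw⟩ : ∃ w, fderiv ℂ f v w ≠ 0 := by
    by_contra! h0
    exact hf (ContinuousLinearMap.ext fun w => by simpa using h0 w)
  exact mul_right_cancel₀ hw ((hc w).trans (hc' w).symm)

lemma IsRatio.smul {f h : Coord → ℂ} {v v' : Coord} {c : ℂ} (hc : IsRatio f h v v' c) (a : ℂ) :
    IsRatio f h v (a • v') (a * c) := by
  intro w
  rw [mul_assoc, hc w]
  simp only [bracket, Prod.smul_fst, Prod.smul_snd, area_smul_right]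
  ring

/-- Since the differential of `f` kills the velocity, it is proportional to the bracket. The factor
is obtained by dividing by whichever transversal partial derivative is nonzero at `s₀`: the two
usual expressions for a Poincaré residue. -/
lemma SmoothEquation.exists_isRatio {f h : Coord → ℂ} {k : ℕ} (hf : SmoothEquation f k)
    (hh : ∀ v, AnalyticAt ℂ h v) {γ : ℂ → Coord} {s₀ : ℂ} (hγ : AnalyticAt ℂ γ s₀)
    (hc : ∀ᶠ s in 𝓝 s₀, γ s ∈ cone f) :
    ∃ c : ℂ → ℂ, AnalyticAt ℂ c s₀ ∧ ∀ᶠ s in 𝓝 s₀, IsRatio f h (γ s) (deriv γ s) (c s) := by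
  obtain ⟨x, hx⟩ := exists_area_eq_one hc.self_of_nhds.1
  obtain ⟨y, hy⟩ := exists_area_eq_one hc.self_of_nhds.2.1
  have hD : ∀ w : Coord, AnalyticAt ℂ (fun s => fderiv ℂ f (γ s) w) s₀ := fun w =>
    (ContinuousLinearMap.apply ℂ ℂ w).analyticAt _ |>.comp
      (((hf.analytic _).fderiv).comp hγ)
  have hh' : AnalyticAt ℂ (fun s => h (γ s)) s₀ := (hh _).comp hγ
  have hγ1 := analyticAt_fst_comp hγ
  have hγ2 := analyticAt_snd_comp hγ
  have hγ1' := analyticAt_fst_comp hγ.deriv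
  have hγ2' := analyticAt_snd_comp hγ.deriv
  have hX := analyticAt_area hγ1 (analyticAt_const (v := x))
  have hY := analyticAt_area hγ2 (analyticAt_const (v := y))
  have eX := hX.continuousAt.eventually_ne (y := 0) (by simp [hx])
  have eY := hY.continuousAt.eventually_ne (y := 0) (by simp [hy])
  have key : ∀ᶠ s in 𝓝 s₀, area (γ s).1 x ≠ 0 ∧ area (γ s).2 y ≠ 0 ∧
      (∀ w, fderiv ℂ f (γ s) w = area (γ s).1 w.1 * (fderiv ℂ f (γ s) (x, 0) / area (γ s).1 x) +
        area (γ s).2 w.2 * (fderiv ℂ f (γ s) (0, y) / area (γ s).2 y)) ∧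
      fderiv ℂ f (γ s) (deriv γ s) = 0 := by
    filter_upwards [eX, eY, hc, hγ.eventually_analyticAt, hc.eventually_nhds] with s h1 h2 h3 h4 h5
    refine ⟨h1, h2, fun w => ?_, ?_⟩
    · rw [hf.fderiv_eq h3.2.2 (x := (area (γ s).1 x)⁻¹ • x) (y := (area (γ s).2 y)⁻¹ • y)
        (by rw [area_smul_right, inv_mul_cancel₀ h1]) (by rw [area_smul_right, inv_mul_cancel₀ h2])]
      have e1 : (((area (γ s).1 x)⁻¹ • x, 0) : Coord) = (area (γ s).1 x)⁻¹ • (x, 0) := by simp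
      have e2 : ((0, (area (γ s).2 y)⁻¹ • y) : Coord) = (area (γ s).2 y)⁻¹ • (0, y) := by simp
      rw [e1, e2, map_smul, map_smul, smul_eq_mul, smul_eq_mul, div_eq_inv_mul, div_eq_inv_mul]
    · have hd := (hf.analytic (γ s)).differentiableAt.hasFDerivAt.comp_hasDerivAt s
        h4.differentiableAt.hasDerivAt
      refine hd.unique ((hasDerivAt_const s (0 : ℂ)).congr_of_eventuallyEq ?_)
      filter_upwards [h5] with r hr using hr.2.2
  by_cases hb : fderiv ℂ f (γ s₀) (0, y) = 0
  · have ha : fderiv ℂ f (γ s₀) (x, 0) ≠ 0 := by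
      intro ha
      refine hf.smooth _ hc.self_of_nhds (ContinuousLinearMap.ext fun w => ?_)
      rw [key.self_of_nhds.2.2.1 w, ha, hb]
      simp
    refine ⟨fun s => -(h (γ s) * area (γ s).2 (deriv γ s).2 *
      area (γ s).1 x / fderiv ℂ f (γ s) (x, 0)), ?_, ?_⟩
    · exact (((hh'.mul (analyticAt_area hγ2 hγ2')).mul hX).div (hD _) ha).neg
    · filter_upwards [key, (hD (x, 0)).continuousAt.eventually_ne ha] with s ⟨h1, h2, h3, h4⟩ h5 w
      rw [h3] at h4
      rw [h3 w, bracket]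
      field_simp at h4 ⊢
      linear_combination - h (γ s) * area (γ s).2 w.2 * h4
  · refine ⟨fun s => h (γ s) * area (γ s).1 (deriv γ s).1 *
      area (γ s).2 y / fderiv ℂ f (γ s) (0, y), ?_, ?_⟩
    · exact (((hh'.mul (analyticAt_area hγ1 hγ1')).mul hY).div (hD _) hb)
    · filter_upwards [key, (hD (0, y)).continuousAt.eventually_ne hb] with s ⟨h1, h2, h3, h4⟩ h5 w
      rw [h3] at h4
      rw [h3 w, bracket]
      field_simp at h4 ⊢
      linear_combination h (γ s) * area (γ s).1 w.1 * h4

/-! ### One-variable analysis: local inverses, ramification and periodic functions. -/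

/-- A holomorphic inverse of a function with nonvanishing derivative. -/
lemma exists_analytic_right_inverse {T : ℂ → ℂ} {s : ℂ} (hT : AnalyticAt ℂ T s)
    (hd : deriv T s ≠ 0) :
    ∃ σ : ℂ → ℂ, AnalyticAt ℂ σ (T s) ∧ σ (T s) = s ∧ ∀ᶠ t in 𝓝 (T s), T (σ t) = t := by
  have hd' : HasFDerivAt T
      (ContinuousLinearEquiv.unitsEquivAut ℂ (Units.mk0 _ hd) : ℂ →L[ℂ] ℂ) s := by
    have := hT.differentiableAt.hasDerivAt.hasFDerivAt
    convert! this using 1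
  have hc : ContDiffAt ℂ ⊤ T s := hT.contDiffAt
  refine ⟨hc.localInverse hd' (by simp), (hc.to_localInverse hd' (by simp)).analyticAt,
    hc.localInverse_apply_image hd' (by simp), ?_⟩
  exact (hc.hasStrictFDerivAt' hd' (by simp)).eventually_right_inverse

/-- With `T s - T 0 = s ^ n * g s`, `g 0 ≠ 0` and `n ≥ 1`, the quotient by the derivative is `s * g
/ (n * g + s * g')`. This is the estimate that makes the singularities at ramification points
removable. -/
lemma exists_sub_div_deriv {T : ℂ → ℂ} (hT : AnalyticAt ℂ T 0)
    (hne : ¬ ∀ᶠ s in 𝓝 0, T s = T 0) :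
    ∃ r : ℂ → ℂ, ContinuousAt r 0 ∧ r 0 = 0 ∧
      ∀ᶠ s in 𝓝[≠] 0, deriv T s ≠ 0 ∧ (T s - T 0) / deriv T s = r s := by
  have hT' : AnalyticAt ℂ (fun s => T s - T 0) 0 := hT.sub analyticAt_const
  have hne' : ¬ ∀ᶠ s in 𝓝 0, T s - T 0 = 0 := by simpa only [sub_eq_zero] using hne
  obtain ⟨n, g, hg, hg0, he⟩ := hT'.exists_eventuallyEq_pow_smul_nonzero_iff.2 hne'
  simp only [sub_zero, smul_eq_mul] at he
  have hn : n ≠ 0 := by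
    rintro rfl
    have := he.self_of_nhds
    simp at this
    exact hg0 this.symm
  obtain ⟨m, rfl⟩ := Nat.exists_eq_succ_of_ne_zero hn
  have hden : AnalyticAt ℂ (fun s => (m + 1 : ℂ) * g s + s * deriv g s) 0 :=
    (analyticAt_const.mul hg).add (analyticAt_id.mul hg.deriv)
  have hden0 : (m + 1 : ℂ) * g 0 + 0 * deriv g 0 ≠ 0 := by
    simpa [hg0] using (by exact_mod_cast m.succ_ne_zero : (m + 1 : ℂ) ≠ 0)
  refine ⟨fun s => s * g s / ((m + 1 : ℂ) * g s + s * deriv g s), ?_, by simp, ?_⟩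
  · exact ((analyticAt_id.mul hg).div hden hden0).continuousAt
  · rw [eventually_nhdsWithin_iff]
    filter_upwards [he, he.eventually_nhds, hg.eventually_analyticAt,
      hden.continuousAt.eventually_ne hden0] with s h1 h2 h3 h4 h5
    have hs : s ≠ 0 := h5
    have hd : deriv T s = s ^ m * ((m + 1 : ℂ) * g s + s * deriv g s) := by
      have e1 : HasDerivAt (fun s => s ^ (m + 1) * g s)
          ((((m + 1 : ℕ) : ℂ) * s ^ m) * g s + s ^ (m + 1) * deriv g s) s := by
        exact (hasDerivAt_pow (m + 1) s).mul h3.differentiableAt.hasDerivAt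
      have e2 := (e1.congr_of_eventuallyEq h2).add_const (T 0)
      simp only [sub_add_cancel] at e2
      rw [e2.deriv]
      push_cast
      ring
    refine ⟨by rw [hd]; exact mul_ne_zero (pow_ne_zero _ hs) h4, ?_⟩
    rw [hd, h1, pow_succ]
    field_simp

/-- An entire function which is periodic for a lattice is constant. -/
lemma exists_const_of_periodic (L : PeriodPair) {u : ℂ → ℂ} (hu : Differentiable ℂ u)
    (hp : ∀ t, ∀ l ∈ L.lattice, u (t + l) = u t) : ∃ c, ∀ t, u t = c := by
  refine hu.exists_const_forall_eq_of_bounded ?_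
  have hb := (ZSpan.fundamentalDomain_isBounded L.basis).isCompact_closure
  refine (hb.image hu.continuous).isBounded.subset ?_
  rintro _ ⟨t, rfl⟩
  refine ⟨ZSpan.fract L.basis t, subset_closure (ZSpan.fract_mem_fundamentalDomain _ _), ?_⟩
  have h := ZSpan.floor L.basis t
  have hmem : (ZSpan.floor L.basis t : ℂ) ∈ L.lattice := by
    rw [L.lattice_eq_span_range_basis]
    exact (ZSpan.floor L.basis t).2
  have := hp (ZSpan.fract L.basis t) _ hmem
  rw [← this, ZSpan.fract_apply, sub_add_cancel]

/-- A periodic function on the complement of a discrete set, with at most removable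
singularities, is constant. -/
lemma exists_const_of_periodic_removable (L : PeriodPair) {u : ℂ → ℂ}
    (hp : ∀ t, ∀ l ∈ L.lattice, u (t + l) = u t)
    (ha : ∀ t₀, ∀ᶠ t in 𝓝[≠] t₀, AnalyticAt ℂ u t)
    (ho : ∀ t₀, Tendsto (fun t => (t - t₀) * u t) (𝓝[≠] t₀) (𝓝 0)) :
    ∃ c, ∀ t, ContinuousAt u t → u t = c := by
  -- The values of `u` at singular points are arbitrary, so `u` is replaced by its limits; the
  -- conclusion concerns only points of continuity of `u`.
  let U : ℂ → ℂ := fun t => limUnder (𝓝[≠] t) u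
  have hU : ∀ t, ContinuousAt u t → U t = u t := fun t ht =>
    (ht.tendsto.mono_left nhdsWithin_le_nhds).limUnder_eq
  have hlim : ∀ t₀, Tendsto u (𝓝[≠] t₀) (𝓝 (U t₀)) := by
    intro t₀
    refine Complex.tendsto_limUnder_of_differentiable_on_punctured_nhds_of_isLittleO
      ((ha t₀).mono fun t ht => ht.differentiableAt) ?_
    rw [Asymptotics.isLittleO_iff_tendsto']
    · have h1 : Tendsto (fun t => (t - t₀) * u t - (t - t₀) * u t₀) (𝓝[≠] t₀) (𝓝 (0 - 0)) := by
        refine (ho t₀).sub ?_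
        have : ContinuousAt (fun t => (t - t₀) * u t₀) t₀ := by fun_prop
        simpa using this.tendsto.mono_left nhdsWithin_le_nhds
      rw [sub_zero] at h1
      refine h1.congr fun t => ?_
      rw [div_inv_eq_mul]
      ring
    · filter_upwards [self_mem_nhdsWithin] with t ht h0
      exact absurd h0 (inv_ne_zero (sub_ne_zero.2 ht))
  have hUa : ∀ t₀, AnalyticAt ℂ U t₀ := by
    intro t₀
    have hev : ∀ᶠ t in 𝓝[≠] t₀, AnalyticAt ℂ U t := by
      have h2 : ∀ᶠ t in 𝓝[≠] t₀, ∀ᶠ r in 𝓝 t, AnalyticAt ℂ u r :=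
        (ha t₀).mono fun t ht => ht.eventually_analyticAt
      filter_upwards [ha t₀, h2] with t ht ht2
      exact ht.congr (ht2.mono fun r hr => (hU r hr.continuousAt).symm)
    refine Complex.analyticAt_of_differentiable_on_punctured_nhds_of_continuousAt
      (hev.mono fun t ht => ht.differentiableAt) ?_
    rw [continuousAt_iff_punctured_nhds]
    refine (hlim t₀).congr' ?_
    filter_upwards [ha t₀] with t ht using (hU t ht.continuousAt).symm
  have hUp : ∀ t, ∀ l ∈ L.lattice, U (t + l) = U t := by
    intro t l hl
    refine tendsto_nhds_unique (f := u) (l := 𝓝[≠] (t + l)) (hlim (t + l)) ?_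
    have h3 : Tendsto (fun r => r - l) (𝓝[≠] (t + l)) (𝓝[≠] t) := by
      refine tendsto_nhdsWithin_iff.2 ⟨?_, ?_⟩
      · have : ContinuousAt (fun r : ℂ => r - l) (t + l) := by fun_prop
        simpa using this.tendsto.mono_left nhdsWithin_le_nhds
      · filter_upwards [self_mem_nhdsWithin] with r hr
        simpa [sub_eq_iff_eq_add] using hr
    refine ((hlim t).comp h3).congr fun r => ?_
    simpa using (hp (r - l) l hl).symm
  obtain ⟨c, hc⟩ := exists_const_of_periodic L (fun t => (hUa t).differentiableAt) hUp
  exact ⟨c, fun t ht => by rw [← hU t ht, hc]⟩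

/-! ### Invariant forms descend to constant multiples of `dt`. -/

section Core

variable {ι : Type*} [Finite ι] {f h : Coord → ℂ} {L : PeriodPair} {m : ℕ}
  {A : ι → Matrix.SpecialLinearGroup (Fin 2) ℂ} {q : Coord → ℂ ⧸ L.lattice}

/-- The value at `t` of the form defined by `h`, divided by the differential of the coordinate
of the torus. -/
def TorusRatio (f h : Coord → ℂ) (L : PeriodPair) (q : Coord → ℂ ⧸ L.lattice) (t c : ℂ) : Prop :=
  ∃ γ : ℂ → Coord, AnalyticAt ℂ γ t ∧
    (∀ᶠ s in 𝓝 t, γ s ∈ cone f ∧ L.lattice.mkQ s = q (γ s)) ∧ IsRatio f h (γ t) (deriv γ t) c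

/-- The weights balance: the differential of `f` contributes `a ^ (m + 2) * b ^ (m + 2)`, `h`
contributes `a ^ m * b ^ m` and the bracket `a ^ 2 * b ^ 2`. This is where the bidegree shift by 2
of adjunction enters. -/
lemma IsRatio.of_scale (hf : ∀ v, AnalyticAt ℂ f v) (hfs : BiScaling f (m + 2))
    (hh : BiScaling h m)
    {B : Matrix.SpecialLinearGroup (Fin 2) ℂ} (hfB : ∀ v, f (diagL B.1 v) = f v)
    (hhB : ∀ v, h (diagL B.1 v) = h v) {v v' u u' : Coord} {a b c : ℂ} (ha : a ≠ 0) (hb : b ≠ 0)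
    (h1 : u.1 = a • B.1 *ᵥ v.1) (h2 : u.2 = b • B.1 *ᵥ v.2)
    (h1' : area u.1 u'.1 = a ^ 2 * area v.1 v'.1) (h2' : area u.2 u'.2 = b ^ 2 * area v.2 v'.2)
    (hc : IsRatio f h u u' c) : IsRatio f h v v' c := by
  intro w
  have hu : u = (a • (diagL B.1 v).1, b • (diagL B.1 v).2) := Prod.ext h1 h2
  have key := hc (a • (diagL B.1 w).1, b • (diagL B.1 w).2)
  have e1 : fderiv ℂ f u (a • (diagL B.1 w).1, b • (diagL B.1 w).2) =
      a ^ (m + 2) * b ^ (m + 2) * fderiv ℂ f v w := by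
    rw [hu, hfs.fderiv_scale hf a b (diagL B.1 v) (diagL B.1 w),
      fderiv_apply_of_semiinvariant hf (diagL B.1) 1 (by simpa using hfB)]
    ring
  have e2 : h u = a ^ m * b ^ m * h v := by rw [hu, hh, hhB]
  have e3 : bracket u u' (a • (diagL B.1 w).1, b • (diagL B.1 w).2) =
      a ^ 2 * b ^ 2 * bracket v v' w := by
    simp only [bracket, h1', h2', diagL_apply]
    rw [h1, h2]
    simp only [area_smul_left, area_smul_right, area_mulVec]
    ring
  rw [e1, e2, e3] at key
  have hab : a ^ (m + 2) * b ^ (m + 2) ≠ 0 := mul_ne_zero (pow_ne_zero _ ha) (pow_ne_zero _ hb)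
  refine mul_left_cancel₀ hab ?_
  linear_combination key

/-- Two local lifts of the torus coordinate to the curve differ by some `A i` and by rescalings,
neither of which affects the ratio. -/
lemma TorusRatio.unique (hf : SmoothEquation f (m + 2)) (hh : BiScaling h m)
    (hq : TorusMap f L A q) (hfA : ∀ i v, f (diagL (A i).1 v) = f v)
    (hhA : ∀ i v, h (diagL (A i).1 v) = h v) {t c c' : ℂ} (hc : TorusRatio f h L q t c)
    (hc' : TorusRatio f h L q t c') : c = c' := by
  obtain ⟨γ, hγ, hγc, hr⟩ := hc
  obtain ⟨δ, hδ, hδc, hr'⟩ := hc'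
  obtain ⟨i, hi⟩ := hq.exists_eventually_area hγ hδ (hγc.mono fun s hs => hs.1)
    (hδc.mono fun s hs => hs.1) ((hγc.and hδc).mono fun s hs => hs.1.2.symm.trans hs.2.2)
  have hv := hγc.self_of_nhds.1
  have hu := hδc.self_of_nhds.1
  have hne : ∀ x : Fin 2 → ℂ, x ≠ 0 → (A i).1 *ᵥ x ≠ 0 := by
    intro x hx h0
    obtain ⟨y, hy⟩ := exists_area_eq_one hx
    rw [← area_mulVec (A i), h0] at hy
    simp [area] at hy
  have hi₀ := hi.self_of_nhds
  obtain ⟨a, ha⟩ := eq_smul_of_area_eq_zero (hne _ hv.1) hi₀.1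
  obtain ⟨b, hb⟩ := eq_smul_of_area_eq_zero (hne _ hv.2.1) hi₀.2
  have ha0 : a ≠ 0 := fun h0 => hu.1 (by rw [ha, h0, zero_smul])
  have hb0 : b ≠ 0 := fun h0 => hu.2.1 (by rw [hb, h0, zero_smul])
  have hAd : HasDerivAt (fun s => diagL (A i).1 (γ s)) (diagL (A i).1 (deriv γ t)) t :=
    (diagL (A i).1).hasFDerivAt.comp_hasDerivAt t hγ.differentiableAt.hasDerivAt
  have hδd := hδ.differentiableAt.hasDerivAt
  have h1 := area_deriv_of_eventually_area_eq_zero (hasDerivAt_fst_comp hAd)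
    (hasDerivAt_fst_comp hδd) (hi.mono fun s hs => hs.1) ha
  have h2 := area_deriv_of_eventually_area_eq_zero (hasDerivAt_snd_comp hAd)
    (hasDerivAt_snd_comp hδd) (hi.mono fun s hs => hs.2) hb
  simp only [diagL_apply, area_mulVec] at h1 h2
  exact hr.unique (hf.smooth _ hv) (hr'.of_scale hf.analytic hf.scaling hh (hfA i) (hhA i)
    ha0 hb0 ha hb h1 h2)

/-- Local parametrizations of the curve and of the map to the torus. -/
lemma TorusMap.exists_local {k : ℕ} (hf : SmoothEquation f k) (hq : TorusMap f L A q) {v : Coord}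
    (hv : v ∈ cone f) {t : ℂ} (ht : L.lattice.mkQ t = q v) :
    ∃ (γ : ℂ → Coord) (T : ℂ → ℂ), AnalyticAt ℂ γ 0 ∧ AnalyticAt ℂ T 0 ∧ γ 0 = v ∧ T 0 = t ∧
      (∀ᶠ s in 𝓝 0, γ s ∈ cone f ∧ L.lattice.mkQ (T s) = q (γ s)) ∧
      (∀ᶠ s in 𝓝 0, area (γ s).1 (deriv γ s).1 ≠ 0 ∨ area (γ s).2 (deriv γ s).2 ≠ 0) ∧
      ¬ ∀ᶠ s in 𝓝 0, T s = T 0 := by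
  obtain ⟨γ, hγ, rfl, hc, him⟩ := hf.exists_param hv
  obtain ⟨F, hF, hFt, hFq⟩ := hq.lift _ hv t ht
  have hT : ∀ᶠ s in 𝓝 0, γ s ∈ cone f ∧ L.lattice.mkQ (F (γ s)) = q (γ s) := by
    filter_upwards [hc, hγ.continuousAt.eventually hFq] with s h1 h2 using ⟨h1, h2 h1⟩
  refine ⟨γ, fun s => F (γ s), hγ, hF.fun_comp hγ, rfl, hFt, hT, him, fun hcon => ?_⟩
  refine hq.not_eventually_const hγ hc him.self_of_nhds ?_
  filter_upwards [hT, hcon] with s h1 h2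
  rw [← h1.2, h2, hT.self_of_nhds.2]

/-- Reparametrization of a curve by the coordinate of the torus. -/
lemma torusRatio_of_deriv_ne_zero {γ : ℂ → Coord} {T : ℂ → ℂ} {s c : ℂ} (hγ : AnalyticAt ℂ γ s)
    (hT : AnalyticAt ℂ T s) (hd : deriv T s ≠ 0)
    (hc : ∀ᶠ r in 𝓝 s, γ r ∈ cone f ∧ L.lattice.mkQ (T r) = q (γ r))
    (hr : IsRatio f h (γ s) (deriv γ s) c) : TorusRatio f h L q (T s) (c / deriv T s) := by
  obtain ⟨σ, hσ, hσs, hσT⟩ := exists_analytic_right_inverse hT hd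
  have hγ' : AnalyticAt ℂ γ (σ (T s)) := by rwa [hσs]
  refine ⟨fun t => γ (σ t), hγ'.fun_comp hσ, ?_, ?_⟩
  · have h1 : ∀ᶠ t in 𝓝 (T s), γ (σ t) ∈ cone f ∧ L.lattice.mkQ (T (σ t)) = q (γ (σ t)) := by
      refine hσ.continuousAt.eventually
        (p := fun r => γ r ∈ cone f ∧ L.lattice.mkQ (T r) = q (γ r)) ?_
      rwa [hσs]
    filter_upwards [h1, hσT] with t h1 h2
    rw [h2] at h1
    exact h1
  · have h2 : HasDerivAt (fun t => γ (σ t)) (deriv σ (T s) • deriv γ s) (T s) := by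
      have := hγ'.differentiableAt.hasDerivAt
      rw [hσs] at this
      refine HasDerivAt.scomp (h := σ) (g₁ := γ) (T s) ?_ hσ.differentiableAt.hasDerivAt
      rwa [hσs]
    have h3 : deriv T s * deriv σ (T s) = 1 := by
      have e1 : HasDerivAt (fun t => T (σ t)) (deriv T s * deriv σ (T s)) (T s) := by
        refine HasDerivAt.comp (h := σ) (h₂ := T) (T s) ?_ hσ.differentiableAt.hasDerivAt
        rw [hσs]
        exact hT.differentiableAt.hasDerivAt
      exact e1.unique ((hasDerivAt_id (T s)).congr_of_eventuallyEq hσT)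
    rw [h2.deriv]
    dsimp only
    rw [hσs]
    have h4 : deriv σ (T s) = (deriv T s)⁻¹ := eq_inv_of_mul_eq_one_right h3
    rw [h4, div_eq_inv_mul]
    exact hr.smul _

/-- The form defined by an invariant `h` is a constant multiple of the invariant form of the
torus. -/
lemma exists_torusRatio_const (hf : SmoothEquation f (m + 2)) (hh : BiScaling h m)
    (hha : ∀ v, AnalyticAt ℂ h v)
    (hq : TorusMap f L A q) (hfA : ∀ i v, f (diagL (A i).1 v) = f v)
    (hhA : ∀ i v, h (diagL (A i).1 v) = h v) : ∃ c₀, ∀ t c, TorusRatio f h L q t c → c = c₀ := by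
  classical
  -- The default 0 is used where the torus coordinate has no local analytic lift, as may happen at
  -- branch values; these are isolated.
  let u : ℂ → ℂ := fun t => if H : ∃ c, TorusRatio f h L q t c then H.choose else 0
  have hu : ∀ t c, TorusRatio f h L q t c → u t = c := by
    intro t c hc
    have H : ∃ c, TorusRatio f h L q t c := ⟨c, hc⟩
    simp only [u, dif_pos H]
    exact H.choose_spec.unique hf hh hq hfA hhA hc
  have hua : ∀ t c, TorusRatio f h L q t c → AnalyticAt ℂ u t := by
    rintro t c ⟨γ, hγ, hγc, -⟩
    obtain ⟨c', hc', hr⟩ := hf.exists_isRatio hha hγ (hγc.mono fun s hs => hs.1)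
    refine hc'.congr ?_
    filter_upwards [hγ.eventually_analyticAt, hγc.eventually_nhds, hr] with s h1 h2 h3
    exact (hu s _ ⟨γ, h1, h2, h3⟩).symm
  have hup : ∀ t, ∀ l ∈ L.lattice, u (t + l) = u t := by
    have hshift : ∀ t, ∀ l ∈ L.lattice, ∀ c, TorusRatio f h L q t c →
        TorusRatio f h L q (t + l) c := by
      rintro t l hl c ⟨γ, hγ, hγc, hr⟩
      have htl : t + l - l = t := add_sub_cancel_right t l
      have hsub : AnalyticAt ℂ (fun s : ℂ => s - l) (t + l) := analyticAt_id.sub analyticAt_const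
      have hγ' : AnalyticAt ℂ γ (t + l - l) := by rwa [htl]
      refine ⟨fun s => γ (s - l), hγ'.fun_comp (f := fun s : ℂ => s - l) hsub, ?_, ?_⟩
      · have h1 : ∀ᶠ s in 𝓝 (t + l), γ (s - l) ∈ cone f ∧
            L.lattice.mkQ (s - l) = q (γ (s - l)) := by
          refine hsub.continuousAt.eventually
            (p := fun s => γ s ∈ cone f ∧ L.lattice.mkQ s = q (γ s)) ?_
          dsimp only
          rwa [htl]
        filter_upwards [h1] with s hs
        refine ⟨hs.1, hs.2 ▸ ?_⟩
        have hl0 : L.lattice.mkQ l = 0 := (Submodule.Quotient.mk_eq_zero L.lattice).2 hl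
        rw [map_sub, hl0, sub_zero]
      · rw [deriv_comp_sub_const]
        dsimp only
        rwa [htl]
    intro t l hl
    by_cases H : ∃ c, TorusRatio f h L q t c
    · obtain ⟨c, hc⟩ := H
      rw [hu t c hc, hu _ c (hshift t l hl c hc)]
    · have H' : ¬ ∃ c, TorusRatio f h L q (t + l) c := by
        rintro ⟨c, hc⟩
        refine H ⟨c, ?_⟩
        simpa using hshift _ (-l) (neg_mem hl) c hc
      simp only [u, dif_neg H, dif_neg H']
  have hloc : ∀ t₀, (∀ᶠ t in 𝓝[≠] t₀, ∃ c, TorusRatio f h L q t c) ∧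
      Tendsto (fun t => (t - t₀) * u t) (𝓝[≠] t₀) (𝓝 0) := by
    intro t₀
    obtain ⟨v, hv, ht⟩ := hq.surj t₀
    obtain ⟨γ, T, hγ, hT, -, hT0, hc, -, hne⟩ := hq.exists_local hf hv ht
    obtain ⟨c, hca, hr⟩ := hf.exists_isRatio hha hγ (hc.mono fun s hs => hs.1)
    obtain ⟨r, hrc, hr0, hrT⟩ := exists_sub_div_deriv hT hne
    have hgood : ∀ᶠ s in 𝓝[≠] 0, TorusRatio f h L q (T s) (c s / deriv T s) := by
      filter_upwards [hrT, hr.filter_mono nhdsWithin_le_nhds,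
        hc.eventually_nhds.filter_mono nhdsWithin_le_nhds,
        hγ.eventually_analyticAt.filter_mono nhdsWithin_le_nhds,
        hT.eventually_analyticAt.filter_mono nhdsWithin_le_nhds] with s h1 h2 h3 h4 h5
      exact torusRatio_of_deriv_ne_zero h4 h5 h1.1 h3 h2
    -- `T` is not constant, hence open: its image of a small neighbourhood of 0 fills a
    -- neighbourhood of `t₀`, and a point other than `t₀` can only come from `s ≠ 0`.
    have hmap : ∀ p : ℂ → Prop, (∀ᶠ s in 𝓝[≠] 0, p (T s)) → ∀ᶠ t in 𝓝[≠] t₀, p t := by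
      intro p hp
      have hopen := hT.eventually_constant_or_nhds_le_map_nhds.resolve_left hne
      rw [hT0] at hopen
      rw [eventually_nhdsWithin_iff] at hp ⊢
      have : ∀ᶠ s in 𝓝 0, T s ∈ ({t₀}ᶜ : Set ℂ) → p (T s) := by
        filter_upwards [hp] with s hs hTs
        refine hs fun h0 => hTs ?_
        rw [Set.mem_singleton_iff.1 h0, hT0]
        rfl
      exact hopen this
    refine ⟨hmap _ (hgood.mono fun s hs => ⟨_, hs⟩), ?_⟩
    rw [Metric.tendsto_nhds]
    intro ε hε
    refine hmap _ ?_
    -- On the lift, `(t - t₀) * u t` becomes `(T s - T 0) / T' s * c s`, which tends to 0.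
    have hlim : Tendsto (fun s => r s * c s) (𝓝[≠] 0) (𝓝 0) := by
      have := (hrc.mul hca.continuousAt).tendsto.mono_left (nhdsWithin_le_nhds (s := {0}ᶜ))
      rw [Pi.mul_apply, hr0, zero_mul] at this
      exact this
    filter_upwards [Metric.tendsto_nhds.1 hlim ε hε, hgood, hrT] with s h1 h2 h3
    rw [hu _ _ h2]
    rw [← h3.2, hT0] at h1
    convert! h1 using 2
    ring
  obtain ⟨c₀, hc₀⟩ := exists_const_of_periodic_removable L hup
    (fun t₀ => (hloc t₀).1.mono fun t ⟨c, hc⟩ => hua t c hc) fun t₀ => (hloc t₀).2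
  exact ⟨c₀, fun t c hc => by rw [← hu t c hc, hc₀ t (hua t c hc).continuousAt]⟩

/-- If the constant of an invariant form vanishes, so does the form. -/
lemma eq_zero_of_torusRatio (hf : SmoothEquation f (m + 2)) (hha : ∀ v, AnalyticAt ℂ h v)
    (hq : TorusMap f L A q) (h0 : ∀ t c, TorusRatio f h L q t c → c = 0) {v : Coord}
    (hv : v ∈ cone f) : h v = 0 := by
  obtain ⟨t, ht⟩ := L.lattice.mkQ_surjective (q v)
  obtain ⟨γ, T, hγ, hT, hγ0, -, hc, him, hne⟩ := hq.exists_local hf hv ht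
  obtain ⟨c, hca, hr⟩ := hf.exists_isRatio hha hγ (hc.mono fun s hs => hs.1)
  obtain ⟨_, -, -, hrT⟩ := exists_sub_div_deriv hT hne
  -- Away from ramification the ratio vanishes while the bracket does not, the curve being immersed,
  -- so `h` vanishes; continuity covers the remaining point.
  have hz : ∀ᶠ s in 𝓝[≠] 0, h (γ s) = 0 := by
    filter_upwards [hrT, hr.filter_mono nhdsWithin_le_nhds,
        hc.eventually_nhds.filter_mono nhdsWithin_le_nhds,
        hγ.eventually_analyticAt.filter_mono nhdsWithin_le_nhds,
        hT.eventually_analyticAt.filter_mono nhdsWithin_le_nhds,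
        him.filter_mono nhdsWithin_le_nhds] with s h1 h2 h3 h4 h5 h6
    have := h0 _ _ (torusRatio_of_deriv_ne_zero h4 h5 h1.1 h3 h2)
    rw [div_eq_zero_iff, or_iff_left h1.1] at this
    rw [this] at h2
    obtain ⟨x, hx⟩ := exists_area_eq_one h3.self_of_nhds.1.1
    obtain ⟨y, hy⟩ := exists_area_eq_one h3.self_of_nhds.1.2.1
    have e1 := h2 (0, y)
    have e2 := h2 (x, 0)
    simp only [bracket, hx, hy, zero_mul] at e1 e2
    have z : ∀ x : Fin 2 → ℂ, area x 0 = 0 := fun x => by simp [area]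
    rw [z] at e1 e2
    rcases h6 with h6 | h6
    · exact (mul_eq_zero.1 e1.symm).resolve_right (by simpa using h6)
    · exact (mul_eq_zero.1 e2.symm).resolve_right (by simpa using h6)
  have hcont : ContinuousAt (fun s => h (γ s)) 0 := ((hha _).comp hγ).continuousAt
  have := tendsto_nhds_unique (hcont.tendsto.mono_left nhdsWithin_le_nhds)
    (tendsto_const_nhds.congr' (hz.mono fun s hs => hs.symm))
  rwa [hγ0] at this

/-- The invariant holomorphic forms are pairwise proportional. -/
theorem exists_linear_relation {h₁ h₂ : Coord → ℂ} (hf : SmoothEquation f (m + 2))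
    (hq : TorusMap f L A q) (hfA : ∀ i v, f (diagL (A i).1 v) = f v)
    (hs₁ : BiScaling h₁ m) (ha₁ : ∀ v, AnalyticAt ℂ h₁ v)
    (hA₁ : ∀ i v, h₁ (diagL (A i).1 v) = h₁ v)
    (hs₂ : BiScaling h₂ m) (ha₂ : ∀ v, AnalyticAt ℂ h₂ v)
    (hA₂ : ∀ i v, h₂ (diagL (A i).1 v) = h₂ v) :
    ∃ a b : ℂ, (a ≠ 0 ∨ b ≠ 0) ∧ ∀ v ∈ cone f, a * h₁ v + b * h₂ v = 0 := by
  obtain ⟨c₁, hc₁⟩ := exists_torusRatio_const hf hs₁ ha₁ hq hfA hA₁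
  obtain ⟨c₂, hc₂⟩ := exists_torusRatio_const hf hs₂ ha₂ hq hfA hA₂
  have key : ∀ a b : ℂ, a * c₁ + b * c₂ = 0 → ∀ v ∈ cone f, a * h₁ v + b * h₂ v = 0 := by
    intro a b hab v hv
    refine eq_zero_of_torusRatio (h := fun v => a * h₁ v + b * h₂ v) hf
      (fun v => (analyticAt_const.mul (ha₁ v)).add (analyticAt_const.mul (ha₂ v))) hq ?_ hv
    rintro t c ⟨γ, hγ, hγc, hr⟩
    obtain ⟨d₁, -, hd₁⟩ := hf.exists_isRatio ha₁ hγ (hγc.mono fun s hs => hs.1)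
    obtain ⟨d₂, -, hd₂⟩ := hf.exists_isRatio ha₂ hγ (hγc.mono fun s hs => hs.1)
    have e₁ := hc₁ _ _ ⟨γ, hγ, hγc, hd₁.self_of_nhds⟩
    have e₂ := hc₂ _ _ ⟨γ, hγ, hγc, hd₂.self_of_nhds⟩
    refine hr.unique (hf.smooth _ hγc.self_of_nhds.1) fun w => ?_
    have w₁ := hd₁.self_of_nhds w
    have w₂ := hd₂.self_of_nhds w
    rw [e₁] at w₁
    rw [e₂] at w₂
    linear_combination a * w₁ + b * w₂ - fderiv ℂ f (γ t) w * hab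
  by_cases h0 : c₁ = 0
  · exact ⟨1, 0, Or.inl one_ne_zero, key 1 0 (by simp [h0])⟩
  · exact ⟨c₂, -c₁, Or.inr (neg_ne_zero.2 h0), key _ _ (by ring)⟩

end Core

/-! ### Exclusion of degree one. -/

section Rational

variable {ι : Type*} {f : Coord → ℂ} {L : PeriodPair}
  {A : ι → Matrix.SpecialLinearGroup (Fin 2) ℂ} {q : Coord → ℂ ⧸ L.lattice}

/-- Two lifts differ by a continuous function with values in the discrete lattice, hence by a local
constant. -/
lemma deriv_eq_of_mkQ_eq {T₁ T₂ : ℂ → ℂ} {s : ℂ} (h₁ : AnalyticAt ℂ T₁ s) (h₂ : AnalyticAt ℂ T₂ s)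
    (h : ∀ᶠ r in 𝓝 s, L.lattice.mkQ (T₁ r) = L.lattice.mkQ (T₂ r)) : deriv T₁ s = deriv T₂ s := by
  have hc := (h₁.sub h₂).continuousAt.eventually
    (L.compl_lattice_sdiff_singleton_mem_nhds ((T₁ - T₂) s))
  have he : T₁ =ᶠ[𝓝 s] fun r => T₂ r + (T₁ - T₂) s := by
    filter_upwards [hc, h] with r h1 h2
    have h3 : T₁ r - T₂ r ∈ L.lattice := (Submodule.Quotient.eq _).1 h2
    by_contra hne
    exact h1 ⟨h3, fun h4 => hne (by rw [← h4]; simp)⟩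
  rw [he.deriv_eq, deriv_add_const]

/-- The differential of the coordinate of the torus along an entire curve. -/
lemma TorusMap.exists_entire_deriv (hq : TorusMap f L A q) {γ : ℂ → Coord}
    (hγ : ∀ s, AnalyticAt ℂ γ s) (hc : ∀ s, γ s ∈ cone f) :
    ∃ D : ℂ → ℂ, Differentiable ℂ D ∧
      (∀ s, ∃ T : ℂ → ℂ, AnalyticAt ℂ T s ∧ ∀ᶠ r in 𝓝 s, L.lattice.mkQ (T r) = q (γ r)) ∧
      ∀ s T, AnalyticAt ℂ T s → (∀ᶠ r in 𝓝 s, L.lattice.mkQ (T r) = q (γ r)) →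
        deriv T s = D s := by
  have hex : ∀ s, ∃ T : ℂ → ℂ, AnalyticAt ℂ T s ∧
      ∀ᶠ r in 𝓝 s, L.lattice.mkQ (T r) = q (γ r) := by
    intro s
    obtain ⟨t, ht⟩ := L.lattice.mkQ_surjective (q (γ s))
    obtain ⟨F, hF, -, hFq⟩ := hq.lift _ (hc s) t ht
    refine ⟨fun r => F (γ r), hF.fun_comp (hγ s), ?_⟩
    filter_upwards [(hγ s).continuousAt.eventually hFq] with r hr using hr (hc r)
  choose T hT hTq using hex
  have hD : ∀ s T', AnalyticAt ℂ T' s → (∀ᶠ r in 𝓝 s, L.lattice.mkQ (T' r) = q (γ r)) →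
      deriv T' s = deriv (T s) s := fun s T' h1 h2 =>
    deriv_eq_of_mkQ_eq h1 (hT s) ((h2.and (hTq s)).mono fun r hr => hr.1.trans hr.2.symm)
  refine ⟨fun s => deriv (T s) s, fun s => ?_, fun s => ⟨T s, hT s, hTq s⟩, hD⟩
  refine ((hT s).deriv.congr ?_).differentiableAt
  filter_upwards [(hT s).eventually_analyticAt, (hTq s).eventually_nhds] with r h1 h2
  exact hD r _ h1 h2

/-- The graph of `n` is a projective line, covered by the charts `γ` and `δ`. The pullback of `dt`
would be a holomorphic 1-form on it: `D` is entire and tends to 0 at infinity by the change of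
chart, so it vanishes, and the map would be locally constant. -/
lemma TorusMap.false_of_linear [Finite ι] (hq : TorusMap f L A q)
    (n : (Fin 2 → ℂ) →L[ℂ] (Fin 2 → ℂ)) (hn : ∀ x, x ≠ 0 → (x, n x) ∈ cone f) : False := by
  let e : Fin 2 → Fin 2 → ℂ := fun i => Pi.single i 1
  let lin : ℂ → ℂ → Fin 2 → ℂ := fun a b => a • e 0 + b • e 1
  have hlin0 : ∀ a b, lin a b 0 = a := fun a b => by simp [lin, e]
  have hlin1 : ∀ a b, lin a b 1 = b := fun a b => by simp [lin, e]
  let γ : ℂ → Coord := fun s => (lin 1 s, n (lin 1 s))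
  let δ : ℂ → Coord := fun s => (lin s 1, n (lin s 1))
  have hl1 : ∀ s, AnalyticAt ℂ (fun s => lin 1 s) s := fun s =>
    analyticAt_const.add (analyticAt_id.smul analyticAt_const)
  have hl2 : ∀ s, AnalyticAt ℂ (fun s => lin s 1) s := fun s =>
    (analyticAt_id.smul analyticAt_const).add analyticAt_const
  have hγ : ∀ s, AnalyticAt ℂ γ s := fun s => (hl1 s).prod ((n.analyticAt _).comp (hl1 s))
  have hδ : ∀ s, AnalyticAt ℂ δ s := fun s => (hl2 s).prod ((n.analyticAt _).comp (hl2 s))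
  have hγc : ∀ s, γ s ∈ cone f := fun s => hn _ fun h => by
    have := hlin0 1 s
    rw [h] at this
    simp at this
  have hδc : ∀ s, δ s ∈ cone f := fun s => hn _ fun h => by
    have := hlin1 s 1
    rw [h] at this
    simp at this
  obtain ⟨D, hD, hDex, hDT⟩ := hq.exists_entire_deriv hγ hγc
  obtain ⟨D', hD', -, hDT'⟩ := hq.exists_entire_deriv hδ hδc
  have hrel : ∀ s : ℂ, s ≠ 0 → D s = -(s⁻¹ ^ 2 * D' s⁻¹) := by
    intro s hs
    obtain ⟨T, hT, hTq⟩ := hDex s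
    have hinv : AnalyticAt ℂ (fun r : ℂ => r⁻¹) s⁻¹ := analyticAt_inv (inv_ne_zero hs)
    have hT' : AnalyticAt ℂ T (s⁻¹)⁻¹ := by rwa [inv_inv]
    have h1 : AnalyticAt ℂ (fun r => T r⁻¹) s⁻¹ := hT'.fun_comp hinv
    have h2 : ∀ᶠ r in 𝓝 s⁻¹, L.lattice.mkQ (T r⁻¹) = q (δ r) := by
      have h3 : ∀ᶠ r in 𝓝 s⁻¹, L.lattice.mkQ (T r⁻¹) = q (γ r⁻¹) := by
        refine hinv.continuousAt.eventually (p := fun r => L.lattice.mkQ (T r) = q (γ r)) ?_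
        dsimp only
        rwa [inv_inv]
      filter_upwards [h3, continuousAt_id.eventually_ne (inv_ne_zero hs)] with r h4 h5
      have hr : r ≠ 0 := h5
      rw [h4, ← hq.scale _ (hγc r⁻¹) r hr]
      congr 1
      have : r • lin 1 r⁻¹ = lin r 1 := by
        simp only [lin, smul_add, smul_smul, mul_one, mul_inv_cancel₀ hr]
      simp only [γ, δ, ← map_smul, this]
    have h6 := hDT' _ _ h1 h2
    have h7 : HasDerivAt (fun r => T r⁻¹) (deriv T s * (-(s⁻¹ ^ 2)⁻¹)) s⁻¹ := by
      refine HasDerivAt.comp (h := fun r : ℂ => r⁻¹) (h₂ := T) s⁻¹ ?_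
        (hasDerivAt_inv (inv_ne_zero hs))
      rw [inv_inv]
      exact hT.differentiableAt.hasDerivAt
    rw [h7.deriv, hDT s T hT hTq] at h6
    rw [← h6]
    field_simp
  have hD0 : ∀ s, D s = 0 := by
    refine fun s => hD.apply_eq_of_tendsto_cocompact s ?_
    have hi : Tendsto (fun s : ℂ => s⁻¹) (cocompact ℂ) (𝓝 0) :=
      Metric.cobounded_eq_cocompact (α := ℂ) ▸ tendsto_inv₀_cobounded
    have h1 : ContinuousAt (fun r => -(r ^ 2 * D' r)) 0 :=
      ((continuousAt_id.pow 2).mul hD'.continuous.continuousAt).neg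
    have h2 := h1.tendsto.comp hi
    simp only [ne_eq, OfNat.ofNat_ne_zero, not_false_eq_true, zero_pow, zero_mul, neg_zero] at h2
    refine h2.congr' ?_
    have h3 : ∀ᶠ s : ℂ in cocompact ℂ, s ≠ 0 := by
      have := (isCompact_singleton (x := (0 : ℂ))).compl_mem_cocompact
      filter_upwards [this] with s hs using hs
    filter_upwards [h3] with s hs using (hrel s hs).symm
  obtain ⟨T, hT, hTq⟩ := hDex 0
  have hconst : ∀ᶠ s in 𝓝 0, T s = T 0 := by
    by_contra hne
    obtain ⟨_, -, -, hrT⟩ := exists_sub_div_deriv hT hne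
    have : ∀ᶠ s in 𝓝[≠] (0 : ℂ), False := by
      filter_upwards [hrT, hT.eventually_analyticAt.filter_mono nhdsWithin_le_nhds,
        hTq.eventually_nhds.filter_mono nhdsWithin_le_nhds] with s h1 h2 h3
      exact h1.1 ((hDT s T h2 h3).trans (hD0 s))
    exact this.exists.elim fun _ h => h
  refine hq.not_eventually_const (hγ 0) (Eventually.of_forall hγc) (Or.inl ?_) ?_
  · have h1 : HasDerivAt (fun s => lin 1 s) (e 1) 0 := by
      simpa [lin] using ((hasDerivAt_id (0 : ℂ)).smul_const (e 1)).const_add ((1 : ℂ) • e 0)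
    have h2 := (hasDerivAt_fst_comp (hγ 0).differentiableAt.hasDerivAt).unique h1
    rw [h2]
    simp [area, γ, lin, e]
  · filter_upwards [hTq, hconst] with s h1 h2
    rw [← h1, h2, hTq.self_of_nhds]

end Rational

/-- The quotient of a smooth curve of bidegree `(1, 1)` is not a torus. -/
theorem TorusMap.false_of_degree_one {ι : Type*} [Finite ι] {f : Coord → ℂ} {L : PeriodPair}
    {A : ι → Matrix.SpecialLinearGroup (Fin 2) ℂ} {q : Coord → ℂ ⧸ L.lattice}
    (hf : SmoothEquation f 1) (hq : TorusMap f L A q) : False := by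
  have key1 : ∀ x y, f (x, y) = fderiv ℂ f (0, y) (x, 0) := by
    intro x y
    have h1 : HasDerivAt (fun s : ℂ => ((0, y) : Coord) + s • ((x, 0) : Coord)) (x, 0) 0 := by
      simpa using ((hasDerivAt_id (0 : ℂ)).smul_const ((x, 0) : Coord)).const_add (0, y)
    have h2 : HasFDerivAt f (fderiv ℂ f (0, y)) ((0, y) + (0 : ℂ) • ((x, 0) : Coord)) := by
      simpa using (hf.analytic (0, y)).differentiableAt.hasFDerivAt
    have h3 := h2.comp_hasDerivAt (0 : ℂ) h1
    have h4 : HasDerivAt (fun s : ℂ => s * f (x, y)) (f (x, y)) 0 := by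
      simpa using (hasDerivAt_id (0 : ℂ)).mul_const (f (x, y))
    refine h4.unique (h3.congr_of_eventuallyEq (Eventually.of_forall fun s => ?_))
    have := hf.scaling s 1 (x, y)
    simp only [pow_one, mul_one, one_smul] at this
    simp [← this]
  have key2 : ∀ x y, f (x, y) = fderiv ℂ f (x, 0) (0, y) := by
    intro x y
    have h1 : HasDerivAt (fun s : ℂ => ((x, 0) : Coord) + s • ((0, y) : Coord)) (0, y) 0 := by
      simpa using ((hasDerivAt_id (0 : ℂ)).smul_const ((0, y) : Coord)).const_add (x, 0)
    have h2 : HasFDerivAt f (fderiv ℂ f (x, 0)) ((x, 0) + (0 : ℂ) • ((0, y) : Coord)) := by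
      simpa using (hf.analytic (x, 0)).differentiableAt.hasFDerivAt
    have h3 := h2.comp_hasDerivAt (0 : ℂ) h1
    have h4 : HasDerivAt (fun s : ℂ => s * f (x, y)) (f (x, y)) 0 := by
      simpa using (hasDerivAt_id (0 : ℂ)).mul_const (f (x, y))
    refine h4.unique (h3.congr_of_eventuallyEq (Eventually.of_forall fun s => ?_))
    have := hf.scaling 1 s (x, y)
    simp only [pow_one, one_mul, one_smul] at this
    simp [← this]
  let g : Fin 2 → (Fin 2 → ℂ) →L[ℂ] ℂ := fun i =>
    (fderiv ℂ f (0, Pi.single i 1)).comp (ContinuousLinearMap.inl ℂ _ _)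
  have hg : ∀ i x, g i x = f (x, Pi.single i 1) := fun i x => (key1 x _).symm
  -- Chosen so that `f (x, y) = area (n x) y`; the curve is then the graph of the projective map of
  -- `n`.
  let n : (Fin 2 → ℂ) →L[ℂ] (Fin 2 → ℂ) := ContinuousLinearMap.pi ![g 1, -g 0]
  have hn0 : ∀ x, n x 0 = g 1 x := fun x => by simp [n]
  have hn1 : ∀ x, n x 1 = -g 0 x := fun x => by simp [n]
  have hfn : ∀ x y, f (x, y) = area (n x) y := by
    intro x y
    have hy : ((0, y) : Coord) = y 0 • (0, Pi.single 0 1) + y 1 • (0, Pi.single 1 1) := by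
      ext i
      · simp
      · fin_cases i <;> simp
    rw [key2, hy, map_add, map_smul, map_smul, ← key2, ← key2, ← hg, ← hg, area, hn0, hn1]
    simp only [smul_eq_mul]
    ring
  -- If `n x = 0`, take `z` independent of `x` and `y` proportional to `n z`, or any nonzero `y` if
  -- `n z = 0`: both partial derivatives vanish at `(x, y)`, against smoothness.
  have hnx : ∀ x, x ≠ 0 → n x ≠ 0 := by
    intro x hx h0
    obtain ⟨z, hz⟩ := exists_area_eq_one hx
    obtain ⟨y, hy, hzy⟩ : ∃ y, y ≠ 0 ∧ area (n z) y = 0 := by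
      by_cases h : n z = 0
      · exact ⟨x, hx, by simp [h, area]⟩
      · exact ⟨n z, h, area_self _⟩
    obtain ⟨w, hw⟩ := exists_area_eq_one hy
    have hxy : ∀ y, f (x, y) = 0 := fun y => by rw [hfn, h0]; simp [area]
    have hv : (x, y) ∈ cone f := ⟨hx, hy, hxy y⟩
    refine hf.smooth _ hv (ContinuousLinearMap.ext fun u => ?_)
    have d : ∀ a : Coord, (∀ s : ℂ, f ((x, y) + s • a) = 0) → fderiv ℂ f (x, y) a = 0 := by
      intro a ha
      have h1 : HasDerivAt (fun s : ℂ => ((x, y) : Coord) + s • a) a 0 := by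
        simpa using ((hasDerivAt_id (0 : ℂ)).smul_const a).const_add (x, y)
      have h2 : HasFDerivAt f (fderiv ℂ f (x, y)) ((x, y) + (0 : ℂ) • a) := by
        simpa using (hf.analytic (x, y)).differentiableAt.hasFDerivAt
      exact (h2.comp_hasDerivAt (0 : ℂ) h1).unique
        ((hasDerivAt_const _ _).congr_of_eventuallyEq (Eventually.of_forall ha))
    rw [hf.fderiv_eq hv.2.2 hz hw u, d (z, 0), d (0, w)]
    · simp
    · intro s
      simp [hxy]
    · intro s
      have : ((x, y) + s • ((z, 0) : Coord)) = (x + s • z, y) := by simp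
      rw [this, hfn, map_add, map_smul, h0, zero_add, area_smul_left, hzy, mul_zero]
  exact hq.false_of_linear n fun x hx => ⟨hx, hnx x hx, by rw [hfn, area_self]⟩

/-! ### Bihomogeneous polynomials and divisibility by the equation. -/

/-- Polynomials in the two pairs of homogeneous coordinates. -/
abbrev BiPoly : Type := MvPolynomial (Fin 2 ⊕ Fin 2) ℂ

/-- The function defined by a polynomial. -/
def evalC (f : BiPoly) (v : Coord) : ℂ := eval (Sum.elim v.1 v.2) f

lemma evalC_injective {f g : BiPoly} (h : ∀ v, evalC f v = evalC g v) : f = g := by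
  refine MvPolynomial.funext fun x => ?_
  have := h (x ∘ Sum.inl, x ∘ Sum.inr)
  simpa [evalC, Sum.elim_comp_inl_inr] using this

@[simp] lemma evalC_mul (f g : BiPoly) (v : Coord) : evalC (f * g) v = evalC f v * evalC g v :=
  map_mul _ _ _

@[simp] lemma evalC_add (f g : BiPoly) (v : Coord) : evalC (f + g) v = evalC f v + evalC g v :=
  map_add _ _ _

@[simp] lemma evalC_pow (f : BiPoly) (n : ℕ) (v : Coord) : evalC (f ^ n) v = evalC f v ^ n :=
  map_pow _ _ _

@[simp] lemma evalC_C (c : ℂ) (v : Coord) : evalC (C c) v = c := eval_C _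

/-- The substitution of a matrix in both pairs of variables. -/
def act (A : Matrix (Fin 2) (Fin 2) ℂ) : BiPoly →ₐ[ℂ] BiPoly :=
  aeval (Sum.elim (fun i => ∑ j, C (A i j) * X (Sum.inl j)) fun i => ∑ j, C (A i j) * X (Sum.inr j))

@[simp] lemma evalC_act (A : Matrix (Fin 2) (Fin 2) ℂ) (f : BiPoly) (v : Coord) :
    evalC (act A f) v = evalC f (diagL A v) := by
  have : (eval (Sum.elim v.1 v.2)).comp (act A).toRingHom =
      eval (Sum.elim (A *ᵥ v.1) (A *ᵥ v.2)) := by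
    refine MvPolynomial.ringHom_ext (fun c => by simp) fun i => ?_
    rcases i with i | i <;>
      simp [act, Matrix.mulVec, dotProduct, -Matrix.mulVec_fin_two, -Matrix.cons_mulVec]
  exact congrArg (fun φ => φ f) this

lemma act_mul (A B : Matrix (Fin 2) (Fin 2) ℂ) (f : BiPoly) :
    act (A * B) f = act B (act A f) := by
  refine evalC_injective fun v => ?_
  simp only [evalC_act, diagL_apply, Matrix.mulVec_mulVec]

lemma act_one (f : BiPoly) : act 1 f = f := by
  refine evalC_injective fun v => ?_
  simp

lemma act_inv_act (A : Matrix.SpecialLinearGroup (Fin 2) ℂ) (f : BiPoly) :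
    act (A⁻¹).1 (act A.1 f) = f := by
  rw [← act_mul, ← Matrix.SpecialLinearGroup.coe_mul, mul_inv_cancel,
    Matrix.SpecialLinearGroup.coe_one, act_one]

/-- Forms of bidegree `(m, m)`. -/
structure BiForm (f : BiPoly) (m : ℕ) : Prop where
  homogeneous : f.IsHomogeneous (2 * m)
  scaling : BiScaling (evalC f) m

lemma BiForm.mul {f g : BiPoly} {m n : ℕ} (hf : BiForm f m) (hg : BiForm g n) :
    BiForm (f * g) (m + n) := by
  refine ⟨?_, fun a b v => ?_⟩
  · rw [mul_add]
    exact hf.homogeneous.mul hg.homogeneous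
  · rw [evalC_mul, hf.scaling, hg.scaling, evalC_mul]
    ring

lemma biForm_one : BiForm 1 0 := by
  refine ⟨isHomogeneous_one _ _, fun a b v => ?_⟩
  simp [evalC]

lemma BiForm.pow {f : BiPoly} {m : ℕ} (hf : BiForm f m) (n : ℕ) : BiForm (f ^ n) (m * n) := by
  induction n with
  | zero => simpa using biForm_one
  | succ n ih =>
    rw [pow_succ, Nat.mul_succ]
    exact ih.mul hf

lemma BiForm.add {f g : BiPoly} {m : ℕ} (hf : BiForm f m) (hg : BiForm g m) :
    BiForm (f + g) m := by
  refine ⟨hf.homogeneous.add hg.homogeneous, fun a b v => ?_⟩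
  rw [evalC_add, hf.scaling, hg.scaling, evalC_add]
  ring

lemma BiForm.C_mul {f : BiPoly} {m : ℕ} (hf : BiForm f m) (c : ℂ) : BiForm (C c * f) m := by
  refine ⟨hf.homogeneous.C_mul c, fun a b v => ?_⟩
  rw [evalC_mul, hf.scaling, evalC_mul, evalC_C, evalC_C]
  ring

lemma BiForm.comp_act {f : BiPoly} {m : ℕ} (hf : BiForm f m) (A : Matrix (Fin 2) (Fin 2) ℂ) :
    BiForm (act A f) m := by
  refine ⟨?_, fun a b v => ?_⟩
  · have := hf.homogeneous.aeval (n := 1) (Sum.elim (fun i => ∑ j, C (A i j) * X (Sum.inl j))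
      fun i => ∑ j, C (A i j) * X (Sum.inr j)) (by
        rintro (i | i) <;>
        exact IsHomogeneous.sum _ _ _ fun j _ => (isHomogeneous_X _ _).C_mul _)
    rwa [one_mul] at this
  · rw [evalC_act, evalC_act, ← hf.scaling]
    simp [Matrix.mulVec_smul]

lemma analyticAt_evalC (f : BiPoly) (v : Coord) : AnalyticAt ℂ (evalC f) v := by
  refine AnalyticAt.aeval_mvPolynomial (f := fun v : Coord => Sum.elim v.1 v.2) (fun i => ?_) f
  rcases i with i | i
  · exact ((ContinuousLinearMap.proj i).comp
      (ContinuousLinearMap.fst ℂ (Fin 2 → ℂ) (Fin 2 → ℂ))).analyticAt v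
  · exact ((ContinuousLinearMap.proj i).comp
      (ContinuousLinearMap.snd ℂ (Fin 2 → ℂ) (Fin 2 → ℂ))).analyticAt v

/-- The coordinate functions. -/
def coordL : Fin 2 ⊕ Fin 2 → Coord →L[ℂ] ℂ :=
  Sum.elim (fun i => (ContinuousLinearMap.proj i).comp (ContinuousLinearMap.fst ℂ _ _))
    fun i => (ContinuousLinearMap.proj i).comp (ContinuousLinearMap.snd ℂ _ _)

lemma evalC_X (i : Fin 2 ⊕ Fin 2) (v : Coord) : evalC (X i) v = coordL i v := by
  rcases i with i | i <;> simp [evalC, coordL]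

lemma hasDerivAt_evalC (f : BiPoly) (v w : Coord) (s : ℂ) :
    HasDerivAt (fun r : ℂ => evalC f (v + r • w))
      (∑ i, evalC (pderiv i f) (v + s • w) * coordL i w) s := by
  induction f using MvPolynomial.induction_on with
  | C a =>
    simp only [evalC_C]
    refine (hasDerivAt_const s a).congr_deriv ?_
    simp [evalC]
  | add p q hp hq =>
    simp only [evalC_add]
    refine (hp.add hq).congr_deriv ?_
    simp only [map_add, evalC_add, add_mul, Finset.sum_add_distrib]
  | mul_X p j hp =>
    simp only [evalC_mul]
    have hX : HasDerivAt (fun r : ℂ => evalC (X j) (v + r • w)) (coordL j w) s := by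
      simp only [evalC_X, map_add, map_smul, smul_eq_mul]
      simpa using ((hasDerivAt_id s).mul_const (coordL j w)).const_add (coordL j v)
    refine (hp.mul hX).congr_deriv ?_
    simp only [Derivation.leibniz, pderiv_X, smul_eq_mul, evalC_add,
      evalC_mul, Finset.sum_mul, add_mul, Finset.sum_add_distrib]
    rw [add_comm]
    congr 1
    · rw [Finset.sum_eq_single j]
      · simp [evalC]
      · intro b _ hb
        simp [evalC, hb.symm]
      · simp
    · refine Finset.sum_congr rfl fun i _ => ?_
      ring

lemma fderiv_evalC_ne_zero {f : BiPoly} {v : Coord} {i : Fin 2 ⊕ Fin 2}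
    (hi : evalC (pderiv i f) v ≠ 0) : fderiv ℂ (evalC f) v ≠ 0 := by
  intro h0
  obtain ⟨w, hw⟩ : ∃ w : Coord, ∀ j, coordL j w = if j = i then 1 else 0 := by
    refine ⟨(fun j => if Sum.inl j = i then 1 else 0, fun j => if Sum.inr j = i then 1 else 0), ?_⟩
    rintro (j | j) <;> simp [coordL]
  have h1 := hasDerivAt_evalC f v w 0
  have h2 : HasFDerivAt (evalC f) (fderiv ℂ (evalC f) v) (v + (0 : ℂ) • w) := by
    simpa using (analyticAt_evalC f v).differentiableAt.hasFDerivAt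
  have h3 : HasDerivAt (fun s : ℂ => v + s • w) w 0 := by
    simpa using ((hasDerivAt_id (0 : ℂ)).smul_const w).const_add v
  have h5 := h2.comp_hasDerivAt (0 : ℂ) h3
  have h4 := h1.unique h5
  rw [h0] at h4
  simp only [hw, mul_ite, mul_one, mul_zero, Finset.sum_ite_eq', Finset.mem_univ, if_true,
    zero_smul, add_zero] at h4
  exact hi (h4.trans rfl)

lemma IsBihomogeneous.biForm {f : BiPoly} {k : ℕ} (hf : IsBihomogeneous f k k) : BiForm f k := by
  have hd : ∀ d : Fin 2 ⊕ Fin 2 →₀ ℕ, coeff d f ≠ 0 →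
      d (Sum.inl 0) + d (Sum.inl 1) = k ∧ d (Sum.inr 0) + d (Sum.inr 1) = k := by
    intro d hd
    have := hf hd
    rw [Finsupp.weight_apply, Finsupp.sum_fintype _ _ (by simp)] at this
    simpa [Fin.sum_univ_two, -nsmul_eq_mul] using this
  refine ⟨fun d h => ?_, fun a b v => ?_⟩
  · obtain ⟨h1, h2⟩ := hd d h
    rw [Finsupp.weight_apply, Finsupp.sum_fintype _ _ (by simp)]
    simp only [Fintype.sum_sum_type, Fin.sum_univ_two, Pi.one_apply, smul_eq_mul, mul_one]
    omega
  · simp only [evalC, eval_eq', Finset.mul_sum]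
    refine Finset.sum_congr rfl fun d h => ?_
    obtain ⟨h1, h2⟩ := hd d (mem_support_iff.1 h)
    simp only [Fintype.prod_sum_type, Fin.prod_univ_two, Sum.elim_inl, Sum.elim_inr, Pi.smul_apply,
      smul_eq_mul, mul_pow]
    have e1 : a ^ k = a ^ d (Sum.inl 0) * a ^ d (Sum.inl 1) := by rw [← h1, pow_add]
    have e2 : b ^ k = b ^ d (Sum.inr 0) * b ^ d (Sum.inr 1) := by rw [← h2, pow_add]
    rw [e1, e2]
    ring

/-- Hilbert's Nullstellensatz for the principal ideal of `f`. -/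
lemma exists_dvd_pow_of_vanishing {f g : BiPoly} (h : ∀ v, evalC f v = 0 → evalC g v = 0) :
    ∃ n, f ∣ g ^ n := by
  have hg : g ∈ vanishingIdeal ℂ (MvPolynomial.zeroLocus ℂ (Ideal.span {f})) := by
    rw [mem_vanishingIdeal_iff]
    intro x hx
    have hfx := (mem_zeroLocus_iff.1 hx) f (Ideal.mem_span_singleton_self f)
    have := h (x ∘ Sum.inl, x ∘ Sum.inr)
    simp only [evalC, Sum.elim_comp_inl_inr] at this
    rw [aeval_eq_eval] at hfx ⊢
    exact this hfx
  rw [vanishingIdeal_zeroLocus_eq_radical] at hg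
  obtain ⟨n, hn⟩ := hg
  exact ⟨n, Ideal.mem_span_singleton.1 hn⟩

/-- A polynomial without singular zeros off the coordinate planes `x = 0` and `y = 0` is
squarefree. -/
lemma squarefree_of_smooth {f : BiPoly}
    (hs : ∀ v : Coord, v.1 ≠ 0 → v.2 ≠ 0 → evalC f v = 0 → ∃ i, evalC (pderiv i f) v ≠ 0) :
    f ≠ 0 ∧ Squarefree f := by
  have hf0 : f ≠ 0 := by
    rintro rfl
    obtain ⟨i, hi⟩ := hs (fun _ => 1, fun _ => 1) (fun h => one_ne_zero (congrFun h 0))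
      (fun h => one_ne_zero (congrFun h 0)) (by simp [evalC])
    simp [evalC] at hi
  refine ⟨hf0, ?_⟩
  rw [squarefree_iff_irreducible_sq_not_dvd_of_ne_zero hf0]
  rintro p hp ⟨g, hg⟩
  have hz : ∀ v : Coord, evalC p v = 0 → v.1 = 0 ∨ v.2 = 0 := by
    intro v hv
    by_contra! hne
    obtain ⟨i, hi⟩ := hs v hne.1 hne.2 (by rw [hg]; simp [hv])
    apply hi
    rw [hg]
    simp [Derivation.leibniz, hv]
  -- A repeated factor `p` can vanish only where `x = 0` or `y = 0`, so on the zeros of each `xᵢ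
  -- yᵢ`. It would then be associated to two different variables.
  have hdvd : ∀ i, p ∣ X (Sum.inl i) ∨ p ∣ X (Sum.inr i) := by
    intro i
    obtain ⟨n, hn⟩ := exists_dvd_pow_of_vanishing (f := p) (g := X (Sum.inl i) * X (Sum.inr i))
      (by
        intro v hv
        rw [evalC_mul, evalC_X, evalC_X]
        rcases hz v hv with h | h <;> simp [coordL, h])
    exact hp.prime.dvd_or_dvd (hp.prime.dvd_of_dvd_pow hn)
  have hX : ∀ a b : Fin 2 ⊕ Fin 2, a ≠ b → p ∣ X a → p ∣ X b → False := by
    intro a b hab ha hb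
    have h1 := (hp.associated_of_dvd X_prime.irreducible ha)
    have h2 : (X a : BiPoly) ∣ X b := h1.symm.dvd.trans hb
    exact hab (X_dvd_X.1 h2)
  rcases hdvd 0 with h0 | h0 <;> rcases hdvd 1 with h1 | h1 <;> exact hX _ _ (by simp) h0 h1

lemma dvd_of_vanishing {f g : BiPoly} (hf0 : f ≠ 0) (hf : Squarefree f)
    (h : ∀ v, evalC f v = 0 → evalC g v = 0) : f ∣ g := by
  obtain ⟨n, hn⟩ := exists_dvd_pow_of_vanishing h
  exact (isRadical_iff_squarefree_of_ne_zero hf0).2 hf n g hn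

lemma BiForm.evalC_eq_zero_of_eq_zero {f : BiPoly} {m : ℕ} (hf : BiForm f m) (hm : m ≠ 0)
    {v : Coord} (hv : v.1 = 0 ∨ v.2 = 0) : evalC f v = 0 := by
  rcases hv with hv | hv
  · have := hf.scaling 0 1 v
    rw [zero_pow hm, zero_mul, zero_mul, zero_smul, one_smul, ← hv] at this
    exact this
  · have := hf.scaling 1 0 v
    rw [zero_pow hm, mul_zero, zero_mul, zero_smul, one_smul, ← hv] at this
    exact this

/-- The cone omits the points with `x = 0` or `y = 0`, but there `g` vanishes automatically since `m
≠ 0`. So `f ∣ g`, and the degrees forbid it unless `g = 0`. -/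
lemma BiForm.eq_zero_of_vanishing {f g : BiPoly} {k m : ℕ} (hf : BiForm f k) (hg : BiForm g m)
    (hf0 : f ≠ 0) (hsq : Squarefree f) (hm : m ≠ 0) (hmk : m < k)
    (h : ∀ v ∈ cone (evalC f), evalC g v = 0) : g = 0 := by
  by_contra hg0
  have hdvd : f ∣ g := by
    refine dvd_of_vanishing hf0 hsq fun v hv => ?_
    by_cases hv' : v.1 = 0 ∨ v.2 = 0
    · exact hg.evalC_eq_zero_of_eq_zero hm hv'
    · push Not at hv'
      exact h v ⟨hv'.1, hv'.2, hv⟩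
  obtain ⟨p, rfl⟩ := hdvd
  have hp0 : p ≠ 0 := right_ne_zero_of_mul hg0
  have h1 := totalDegree_mul_of_isDomain hf0 hp0
  rw [hf.homogeneous.totalDegree hf0, hg.homogeneous.totalDegree hg0] at h1
  omega

lemma BiForm.exists_eq_C_mul {f g : BiPoly} {k : ℕ} (hf : BiForm f k) (hg : BiForm g k)
    (hf0 : f ≠ 0) (hsq : Squarefree f) (hk : k ≠ 0)
    (h : ∀ v ∈ cone (evalC f), evalC g v = 0) : ∃ c, g = C c * f := by
  by_cases hg0 : g = 0
  · exact ⟨0, by simp [hg0]⟩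
  have hdvd : f ∣ g := by
    refine dvd_of_vanishing hf0 hsq fun v hv => ?_
    by_cases hv' : v.1 = 0 ∨ v.2 = 0
    · exact hg.evalC_eq_zero_of_eq_zero hk hv'
    · push Not at hv'
      exact h v ⟨hv'.1, hv'.2, hv⟩
  obtain ⟨p, rfl⟩ := hdvd
  have hp0 : p ≠ 0 := right_ne_zero_of_mul hg0
  have h1 := totalDegree_mul_of_isDomain hf0 hp0
  rw [hf.homogeneous.totalDegree hf0, hg.homogeneous.totalDegree hg0] at h1
  have hp : p = C (coeff 0 p) := totalDegree_eq_zero_iff_eq_C.1 (by omega)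
  exact ⟨coeff 0 p, by rw [← hp, mul_comm]⟩

/-! ### From the projective quotient to homogeneous coordinates. -/

lemma mulVec_ne_zero (A : Matrix.SpecialLinearGroup (Fin 2) ℂ) {x : Fin 2 → ℂ} (hx : x ≠ 0) :
    A.1 *ᵥ x ≠ 0 := by
  intro h0
  obtain ⟨y, hy⟩ := exists_area_eq_one hx
  rw [← area_mulVec A, h0] at hy
  simp [area] at hy

lemma psl_smul_mk (A : Matrix.SpecialLinearGroup (Fin 2) ℂ) {x : Fin 2 → ℂ} (hx : x ≠ 0) :
    (QuotientGroup.mk A : PSL2) • (Projectivization.mk ℂ x hx) =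
      Projectivization.mk ℂ (A.1 *ᵥ x) (mulVec_ne_zero A hx) := rfl

lemma mk_smul_eq {x : Fin 2 → ℂ} (hx : x ≠ 0) {a : ℂ} (hax : a • x ≠ 0) :
    Projectivization.mk ℂ (a • x) hax = Projectivization.mk ℂ x hx :=
  (Projectivization.mk_eq_mk_iff' ℂ _ _ _ _).2 ⟨a, rfl⟩

lemma mem_zeroLocus_mk_iff {f : BiPoly} {k : ℕ} (hf : BiForm f k) {x y : Fin 2 → ℂ} (hx : x ≠ 0)
    (hy : y ≠ 0) :
    (Projectivization.mk ℂ x hx, Projectivization.mk ℂ y hy) ∈ PlatonicCurves.zeroLocus f ↔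
      evalC f (x, y) = 0 := by
  obtain ⟨a, ha⟩ := Projectivization.exists_smul_eq_mk_rep ℂ x hx
  obtain ⟨b, hb⟩ := Projectivization.exists_smul_eq_mk_rep ℂ y hy
  have := hf.scaling a b (x, y)
  simp only [PlatonicCurves.zeroLocus, Set.mem_ofPred_eq, ← ha, ← hb]
  change evalC f ((a : ℂ) • x, (b : ℂ) • y) = 0 ↔ _
  rw [this]
  simp

/-- A section of the projection to the torus, holomorphic near a given point. -/
lemma exists_section (L : PeriodPair) (t : ℂ) :
    ∃ φ : ℂ ⧸ L.lattice → ℂ, (∀ τ, L.lattice.mkQ (φ τ) = τ) ∧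
      ∀ᶠ s in 𝓝 t, φ (L.lattice.mkQ s) = s := by
  classical
  obtain ⟨ε, hε, hb⟩ := Metric.mem_nhds_iff.1 (L.compl_lattice_sdiff_singleton_mem_nhds 0)
  have hinj : ∀ s ∈ Metric.ball t (ε / 2), ∀ r ∈ Metric.ball t (ε / 2),
      L.lattice.mkQ s = L.lattice.mkQ r → s = r := by
    intro s hs r hr h
    have h1 : s - r ∈ L.lattice := (Submodule.Quotient.eq _).1 h
    have h2 : s - r ∈ Metric.ball (0 : ℂ) ε := by
      rw [mem_ball_zero_iff, ← dist_eq_norm]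
      have := dist_triangle_right s r t
      rw [Metric.mem_ball] at hs hr
      linarith
    by_contra hne
    exact hb h2 ⟨h1, fun h3 => hne (sub_eq_zero.1 h3)⟩
  have hsurj : ∀ τ, ∃ s, L.lattice.mkQ s = τ := L.lattice.mkQ_surjective
  refine ⟨fun τ => if H : ∃ s ∈ Metric.ball t (ε / 2), L.lattice.mkQ s = τ then H.choose
    else (hsurj τ).choose, fun τ => ?_, ?_⟩
  · dsimp only
    by_cases H : ∃ s ∈ Metric.ball t (ε / 2), L.lattice.mkQ s = τ
    · rw [dif_pos H]
      exact H.choose_spec.2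
    · rw [dif_neg H]
      exact (hsurj τ).choose_spec
  · filter_upwards [Metric.ball_mem_nhds t (half_pos hε)] with s hs
    have H : ∃ r ∈ Metric.ball t (ε / 2), L.lattice.mkQ r = L.lattice.mkQ s := ⟨s, hs, rfl⟩
    rw [dif_pos H]
    exact hinj _ H.choose_spec.1 _ hs H.choose_spec.2

/-- The quotient map of an elliptic quotient, in homogeneous coordinates. -/
theorem exists_torusMap {f : BiPoly} {k : ℕ} (hf : BiForm f k) {S : Set (P1 × P1)}
    (hS : S = PlatonicCurves.zeroLocus f) {G : Subgroup PSL2} (hE : HasEllipticQuotient G S) :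
    ∃ (L : PeriodPair) (q : Coord → ℂ ⧸ L.lattice),
      TorusMap (evalC f) L (fun g : G => Quotient.out g.1) q := by
  classical
  obtain ⟨L, e, he⟩ := hE
  have hmem : ∀ v ∈ cone (evalC f), ∀ (h₁ : v.1 ≠ 0) (h₂ : v.2 ≠ 0),
      (Projectivization.mk ℂ v.1 h₁, Projectivization.mk ℂ v.2 h₂) ∈ S := fun v hv h₁ h₂ => by
    rw [hS, mem_zeroLocus_mk_iff hf]
    exact hv.2.2
  let pt : ∀ v, v ∈ cone (evalC f) → S := fun v hv => ⟨_, hmem v hv hv.1 hv.2.1⟩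
  let q : Coord → ℂ ⧸ L.lattice := fun v =>
    if hv : v ∈ cone (evalC f) then e (Quotient.mk _ (pt v hv)) else 0
  have hq : ∀ v (hv : v ∈ cone (evalC f)), q v = e (Quotient.mk _ (pt v hv)) := fun v hv =>
    dif_pos hv
  have hscale : ∀ v ∈ cone (evalC f), ∀ a b : ℂ, a ≠ 0 → b ≠ 0 →
      ((a • v.1, b • v.2) : Coord) ∈ cone (evalC f) := fun v hv a b ha hb =>
    ⟨smul_ne_zero ha hv.1, smul_ne_zero hb hv.2.1, by rw [hf.scaling, hv.2.2, mul_zero]⟩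
  have hpt : ∀ v (hv : v ∈ cone (evalC f)) (a b : ℂ) (ha : a ≠ 0) (hb : b ≠ 0),
      pt (a • v.1, b • v.2) (hscale v hv a b ha hb) = pt v hv := by
    intro v hv a b ha hb
    apply Subtype.ext
    exact Prod.ext (mk_smul_eq hv.1 _) (mk_smul_eq hv.2.1 _)
  refine ⟨L, q, ?_, ?_, ?_, ?_⟩
  · intro t
    obtain ⟨p, hp⟩ := Quotient.exists_rep (e.symm (L.lattice.mkQ t))
    have hv : (p.1.1.rep, p.1.2.rep) ∈ cone (evalC f) := by
      refine ⟨Projectivization.rep_nonzero _, Projectivization.rep_nonzero _, ?_⟩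
      have h : p.1 ∈ PlatonicCurves.zeroLocus f := hS.subset p.2
      exact h
    refine ⟨_, hv, ?_⟩
    have hpv : pt _ hv = p := by
      apply Subtype.ext
      exact Prod.ext (Projectivization.mk_rep _) (Projectivization.mk_rep _)
    rw [hq _ hv, hpv]
    exact (e.apply_symm_apply _).symm.trans (congrArg e hp.symm)
  · intro v hv a ha
    rw [hq _ hv, hq _ (hscale v hv a a ha ha), hpt v hv a a ha ha]
  · intro v hv w hw h
    rw [hq v hv, hq w hw] at h
    have h1 := Quotient.exact (e.injective h)
    obtain ⟨g, hg⟩ := (orbitSetoid G S).symm' h1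
    refine ⟨g, ?_⟩
    have hA : (QuotientGroup.mk (Quotient.out g.1) : PSL2) = g.1 := Quotient.out_eq g.1
    have hg' : (QuotientGroup.mk (Quotient.out g.1) : PSL2) • (pt v hv).1 = (pt w hw).1 := by
      rw [hA]
      exact hg
    have h2 := congrArg Prod.fst hg'
    have h3 := congrArg Prod.snd hg'
    rw [Prod.smul_fst] at h2
    rw [Prod.smul_snd] at h3
    change (QuotientGroup.mk (Quotient.out g.1) : PSL2) • Projectivization.mk ℂ v.1 hv.1 =
      Projectivization.mk ℂ w.1 hw.1 at h2
    change (QuotientGroup.mk (Quotient.out g.1) : PSL2) • Projectivization.mk ℂ v.2 hv.2.1 =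
      Projectivization.mk ℂ w.2 hw.2.1 at h3
    rw [psl_smul_mk, Projectivization.mk_eq_mk_iff'] at h2 h3
    obtain ⟨a, ha⟩ := h2
    obtain ⟨b, hb⟩ := h3
    rw [← ha, ← hb, area_smul_left, area_smul_left, area_self, area_self]
    simp
  · intro v hv t ht
    -- The definition of an elliptic quotient is about functions on the torus. Applied to a section
    -- `φ` of the projection that is the identity branch near `t`, it yields a holomorphic local
    -- lift of the quotient map.
    obtain ⟨φ, hφ, hφt⟩ := exists_section L t
    rw [hq v hv] at ht
    have han : AnalyticAt ℂ (fun s => φ (L.lattice.mkQ s)) t :=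
      analyticAt_id.congr (hφt.mono fun s hs => hs.symm)
    obtain ⟨x, y, hx, hy, hxy, F, hF, hFφ⟩ := (he φ (pt v hv) t ht.symm).1 han
    have hx1 : Projectivization.mk ℂ x hx = Projectivization.mk ℂ v.1 hv.1 :=
      (congrArg Prod.fst hxy).symm
    have hy1 : Projectivization.mk ℂ y hy = Projectivization.mk ℂ v.2 hv.2.1 :=
      (congrArg Prod.snd hxy).symm
    rw [Projectivization.mk_eq_mk_iff'] at hx1 hy1
    obtain ⟨a, rfl⟩ := hx1
    obtain ⟨b, rfl⟩ := hy1
    have ha : a ≠ 0 := fun h => hx (by rw [h, zero_smul])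
    have hb : b ≠ 0 := fun h => hy (by rw [h, zero_smul])
    have key : ∀ᶠ w in 𝓝 v, ∀ hw : w ∈ cone (evalC f),
        φ (e (Quotient.mk _ (pt w hw))) = F (scaleL a b w) := by
      have h1 : Tendsto (scaleL a b) (𝓝 v) (𝓝 (a • v.1, b • v.2)) :=
        (scaleL a b).continuous.continuousAt
      filter_upwards [h1.eventually hFφ] with w hw hwc
      have hsc := hscale w hwc a b ha hb
      have h2 := hw hsc.1 hsc.2.1 (hmem _ hsc hsc.1 hsc.2.1)
      rw [← hpt w hwc a b ha hb]
      exact h2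
    refine ⟨fun w => F (scaleL a b w), ?_, ?_, ?_⟩
    · exact AnalyticAt.fun_comp (g := F) (f := scaleL a b) hF ((scaleL a b).analyticAt v)
    · dsimp only
      rw [← key.self_of_nhds hv, ← ht]
      exact hφt.self_of_nhds
    · filter_upwards [key] with w hw hwc
      rw [← hw hwc, hφ, hq w hwc]

/-- The equation of a smooth invariant curve is semi-invariant. -/
lemma exists_act_eq_C_mul {f : BiPoly} {k : ℕ} (hf : BiForm f k) (hf0 : f ≠ 0)
    (hsq : Squarefree f) (hk : k ≠ 0) {S : Set (P1 × P1)}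
    (hS : S = PlatonicCurves.zeroLocus f) {A : Matrix.SpecialLinearGroup (Fin 2) ℂ}
    (hinv : ∀ p ∈ S, (QuotientGroup.mk A : PSL2) • p ∈ S) :
    ∃ c, act A.1 f = C c * f := by
  refine hf.exists_eq_C_mul (hf.comp_act A.1) hf0 hsq hk fun v hv => ?_
  have h1 : (Projectivization.mk ℂ v.1 hv.1, Projectivization.mk ℂ v.2 hv.2.1) ∈ S := by
    rw [hS, mem_zeroLocus_mk_iff hf]
    exact hv.2.2
  have h2 := hinv _ h1
  rw [hS] at h2
  rw [evalC_act]
  exact (mem_zeroLocus_mk_iff hf (mulVec_ne_zero A hv.1) (mulVec_ne_zero A hv.2.1)).1 h2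

/-! ### Rotations, their axes, and weights at fixed points. -/

/-- The antipodal map in homogeneous coordinates. -/
def conjPerp (x : Fin 2 → ℂ) : Fin 2 → ℂ := ![-star (x 1), star (x 0)]

lemma conjPerp_smul (a : ℂ) (x : Fin 2 → ℂ) : conjPerp (a • x) = star a • conjPerp x := by
  ext i
  fin_cases i <;> simp [conjPerp]

lemma area_conjPerp_ne_zero {x : Fin 2 → ℂ} (hx : x ≠ 0) : area x (conjPerp x) ≠ 0 := by
  have h : area x (conjPerp x) = ((Complex.normSq (x 0) + Complex.normSq (x 1) : ℝ) : ℂ) := by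
    simp [area, conjPerp, Complex.mul_conj]
  rw [h, Complex.ofReal_ne_zero]
  intro h0
  have h1 := Complex.normSq_nonneg (x 0)
  have h2 := Complex.normSq_nonneg (x 1)
  apply hx
  ext i
  fin_cases i
  · exact Complex.normSq_eq_zero.1 (show Complex.normSq (x 0) = 0 by linarith)
  · exact Complex.normSq_eq_zero.1 (show Complex.normSq (x 1) = 0 by linarith)

lemma conjPerp_ne_zero {x : Fin 2 → ℂ} (hx : x ≠ 0) : conjPerp x ≠ 0 := by
  intro h
  apply area_conjPerp_ne_zero hx
  rw [h]
  simp [area]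

lemma antipode_mk {x : Fin 2 → ℂ} (hx : x ≠ 0) :
    antipode (Projectivization.mk ℂ x hx) =
      Projectivization.mk ℂ (conjPerp x) (conjPerp_ne_zero hx) := by
  obtain ⟨a, ha⟩ := Projectivization.exists_smul_eq_mk_rep ℂ x hx
  refine (Projectivization.mk_eq_mk_iff' ℂ _ _ _ _).2 ⟨star (a : ℂ), ?_⟩
  rw [← conjPerp_smul]
  exact congrArg conjPerp ha

/-- A unitary matrix of determinant 1 has its adjugate as adjoint, which says exactly that it
commutes with the quaternionic structure `conjPerp`. So the two fixed points of a rotation are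
antipodal. -/
lemma mulVec_conjPerp {A : Matrix.SpecialLinearGroup (Fin 2) ℂ}
    (hA : A.1 ∈ Matrix.unitaryGroup (Fin 2) ℂ) (x : Fin 2 → ℂ) :
    A.1 *ᵥ conjPerp x = conjPerp (A.1 *ᵥ x) := by
  have h1 : star A.1 = A.1.adjugate := by
    calc star A.1 = (A.1.adjugate * A.1) * star A.1 := by
          rw [Matrix.adjugate_mul, A.2, one_smul, one_mul]
      _ = A.1.adjugate := by
          rw [mul_assoc, Matrix.mem_unitaryGroup_iff.1 hA, mul_one]
  rw [Matrix.adjugate_fin_two] at h1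
  have e00 := congrFun (congrFun h1 0) 0
  have e01 := congrFun (congrFun h1 0) 1
  have e10 := congrFun (congrFun h1 1) 0
  have e11 := congrFun (congrFun h1 1) 1
  simp only [Matrix.star_apply, Matrix.of_apply, Matrix.cons_val', Matrix.cons_val_zero,
    Matrix.cons_val_one, Matrix.cons_val_fin_one] at e00 e01 e10 e11
  ext i
  fin_cases i
  · simp only [Fin.zero_eta, conjPerp, Matrix.mulVec, dotProduct, Fin.sum_univ_two,
      Matrix.cons_val_zero, Matrix.cons_val_one, star_add, star_mul', e01, e11]
    ring
  · simp only [Fin.mk_one, conjPerp, Matrix.mulVec, dotProduct, Fin.sum_univ_two,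
      Matrix.cons_val_zero, Matrix.cons_val_one, star_add, star_mul', e00, e10]
    ring

lemma exists_eigenvector (A : Matrix (Fin 2) (Fin 2) ℂ) :
    ∃ (l : ℂ) (x : Fin 2 → ℂ), x ≠ 0 ∧ A *ᵥ x = l • x := by
  obtain ⟨l, hl⟩ := Module.End.exists_eigenvalue (Matrix.toLin' A)
  obtain ⟨x, hx⟩ := hl.exists_hasEigenvector
  exact ⟨l, x, hx.2, by simpa using hx.apply_eq_smul⟩

lemma mk_eq_one_of_smul {A : Matrix.SpecialLinearGroup (Fin 2) ℂ} {r : ℂ}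
    (h : ∀ x, A.1 *ᵥ x = r • x) : (QuotientGroup.mk A : PSL2) = 1 := by
  rw [QuotientGroup.eq_one_iff, Matrix.SpecialLinearGroup.mem_center_iff]
  have hA : Matrix.scalar (Fin 2) r = A.1 := by
    refine (Matrix.ext_of_mulVec_single fun i => ?_)
    rw [h]
    ext j
    simp [Matrix.scalar_apply, Matrix.mulVec_diagonal, Pi.single_apply]
  refine ⟨r, ?_, hA⟩
  have := A.2
  rw [← hA] at this
  simpa [Matrix.scalar_apply, Matrix.det_diagonal] using this

/-- The axis of a rotation. -/
lemma IsRotation.exists_axis {g : PSL2} (hg : IsRotation g) :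
    ∃ (A : Matrix.SpecialLinearGroup (Fin 2) ℂ) (l : ℂ) (x : Fin 2 → ℂ),
      (QuotientGroup.mk A : PSL2) = g ∧ l ≠ 0 ∧ x ≠ 0 ∧ A.1 *ᵥ x = l • x ∧
      A.1 *ᵥ conjPerp x = l⁻¹ • conjPerp x ∧ ∀ n : ℕ, (l ^ 2) ^ n = 1 → g ^ n = 1 := by
  obtain ⟨A, hA, rfl⟩ := hg
  obtain ⟨l, x, hx, hl⟩ := exists_eigenvector A.1
  have h1 : A.1 *ᵥ conjPerp x = star l • conjPerp x := by
    rw [mulVec_conjPerp hA, hl, conjPerp_smul]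
  have har := area_conjPerp_ne_zero hx
  have h2 : l * star l = 1 := by
    have := area_mulVec A x (conjPerp x)
    rw [hl, h1, area_smul_left, area_smul_right, ← mul_assoc] at this
    exact mul_right_cancel₀ har (this.trans (one_mul _).symm)
  have hl0 : l ≠ 0 := left_ne_zero_of_mul_eq_one h2
  have h3 : star l = l⁻¹ := eq_inv_of_mul_eq_one_right h2
  rw [h3] at h1
  refine ⟨A, l, x, rfl, hl0, hx, hl, h1, fun n hn => ?_⟩
  have p1 : ∀ n : ℕ, (A ^ n).1 *ᵥ x = l ^ n • x := by
    intro n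
    induction n with
    | zero => simp
    | succ n ih =>
      rw [pow_succ', Matrix.SpecialLinearGroup.coe_mul, ← Matrix.mulVec_mulVec, ih,
        Matrix.mulVec_smul, hl, smul_smul, pow_succ]
  have p2 : ∀ n : ℕ, (A ^ n).1 *ᵥ conjPerp x = l⁻¹ ^ n • conjPerp x := by
    intro n
    induction n with
    | zero => simp
    | succ n ih =>
      rw [pow_succ', Matrix.SpecialLinearGroup.coe_mul, ← Matrix.mulVec_mulVec, ih,
        Matrix.mulVec_smul, h1, smul_smul, pow_succ]
  -- The two eigenvalues of `A ^ n` agree, so `A ^ n` is scalar and trivial in `PSL2`.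
  have h4 : l⁻¹ ^ n = l ^ n := by
    rw [inv_pow]
    refine inv_eq_of_mul_eq_one_left ?_
    rw [← hn]
    ring
  rw [← QuotientGroup.mk_pow]
  refine mk_eq_one_of_smul (r := l ^ n) fun y => ?_
  have hz : area x ((area x (conjPerp x))⁻¹ • conjPerp x) = 1 := by
    rw [area_smul_right, inv_mul_cancel₀ har]
  have hy := eq_area_smul_add hz y
  rw [hy]
  simp only [Matrix.mulVec_add, Matrix.mulVec_smul, p1, p2, h4, smul_add]
  congr 1
  · simp only [smul_smul]
    congr 1
    ring
  · simp only [smul_smul]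
    congr 1
    ring

/-- The character of a semi-invariant smooth equation at a fixed point. -/
lemma SmoothEquation.character_at_fixedPoint {f : BiPoly} {k : ℕ}
    (hs : SmoothEquation (evalC f) k) {A : Matrix (Fin 2) (Fin 2) ℂ} {c : ℂ}
    (hA : act A f = C c * f) {x x' y y' : Fin 2 → ℂ} {α β : ℂ} (hα : α ≠ 0) (hβ : β ≠ 0)
    (hxx : area x x' ≠ 0) (hyy : area y y' ≠ 0) (hx : A *ᵥ x = α • x) (hx' : A *ᵥ x' = α⁻¹ • x')
    (hy : A *ᵥ y = β • y) (hy' : A *ᵥ y' = β⁻¹ • y') :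
    c = α ^ k * β ^ k ∨
      evalC f (x, y) = 0 ∧ (c * α ^ 2 = α ^ k * β ^ k ∨ c * β ^ 2 = α ^ k * β ^ k) := by
  have hAf : ∀ v, evalC f (diagL A v) = c * evalC f v := fun v => by
    rw [← evalC_act, hA, evalC_mul, evalC_C]
  by_cases h0 : evalC f (x, y) = 0
  swap
  · left
    have h1 := hAf (x, y)
    have h2 := hs.scaling α β (x, y)
    simp only [diagL_apply, hx, hy] at h1
    exact mul_right_cancel₀ h0 (h1.symm.trans h2)
  right
  refine ⟨h0, ?_⟩
  have hx0 : x ≠ 0 := fun h => hxx (by rw [h]; simp [area])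
  have hy0 : y ≠ 0 := fun h => hyy (by rw [h]; simp [area])
  have hd := fderiv_apply_of_semiinvariant hs.analytic (diagL A) c hAf (x, y)
  simp only [diagL_apply, hx, hy] at hd
  have hz : area x ((area x x')⁻¹ • x') = 1 := by rw [area_smul_right, inv_mul_cancel₀ hxx]
  have hw : area y ((area y y')⁻¹ • y') = 1 := by rw [area_smul_right, inv_mul_cancel₀ hyy]
  -- By smoothness one of the transversal derivatives is nonzero. The directions `x'` and `y'` have
  -- weights `α ^ (-2)` and `β ^ (-2)` relative to `x` and `y`, whence the extra factor.
  by_cases h1 : fderiv ℂ (evalC f) (x, y) (x', 0) = 0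
  · by_cases h2 : fderiv ℂ (evalC f) (x, y) (0, y') = 0
    · exfalso
      refine hs.smooth _ ⟨hx0, hy0, h0⟩ (ContinuousLinearMap.ext fun u => ?_)
      have e1 : (((area x x')⁻¹ • x', 0) : Coord) = (area x x')⁻¹ • (x', 0) := by simp
      have e2 : ((0, (area y y')⁻¹ • y') : Coord) = (area y y')⁻¹ • (0, y') := by simp
      rw [hs.fderiv_eq h0 (v := (x, y)) hz hw u, e1, e2, map_smul, map_smul, h1, h2]
      simp
    · right
      have h3 := hd (0, y')
      have h4 := hs.scaling.fderiv_scale hs.analytic α β (x, y) ((β ^ 2)⁻¹ • (0, y'))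
      have e : ((α • ((β ^ 2)⁻¹ • ((0, y') : Coord)).1, β • ((β ^ 2)⁻¹ • ((0, y') : Coord)).2)
          : Coord) = (0, β⁻¹ • y') := by
        simp only [Prod.smul_mk, smul_zero, smul_smul]
        congr 2
        field_simp
      rw [e, map_smul, smul_eq_mul] at h4
      simp only [Matrix.mulVec_zero, hy'] at h3
      have h5 := h3.symm.trans h4
      have h6 : c = α ^ k * β ^ k * (β ^ 2)⁻¹ := mul_right_cancel₀ h2 (by rw [h5]; ring)
      rw [h6]
      field_simp
  · left
    have h3 := hd (x', 0)
    have h4 := hs.scaling.fderiv_scale hs.analytic α β (x, y) ((α ^ 2)⁻¹ • (x', 0))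
    have e : ((α • ((α ^ 2)⁻¹ • ((x', 0) : Coord)).1, β • ((α ^ 2)⁻¹ • ((x', 0) : Coord)).2)
        : Coord) = (α⁻¹ • x', 0) := by
      simp only [Prod.smul_mk, smul_zero, smul_smul]
      congr 2
      field_simp
    rw [e, map_smul, smul_eq_mul] at h4
    simp only [Matrix.mulVec_zero, hx'] at h3
    have h5 := h3.symm.trans h4
    have h6 : c = α ^ k * β ^ k * (α ^ 2)⁻¹ := mul_right_cancel₀ h1 (by rw [h5]; ring)
    rw [h6]
    field_simp

/-! ### Action of `PSL2` on forms, and characters. -/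

/-- A form of bidegree `(m, m)` is not changed by the centre of `SL(2, ℂ)`. -/
lemma BiForm.act_eq_of_mk_eq {f : BiPoly} {m : ℕ} (hf : BiForm f m)
    {A B : Matrix.SpecialLinearGroup (Fin 2) ℂ}
    (h : (QuotientGroup.mk A : PSL2) = QuotientGroup.mk B) : act A.1 f = act B.1 f := by
  rw [QuotientGroup.eq, Matrix.SpecialLinearGroup.mem_center_iff] at h
  obtain ⟨r, hr, hrA⟩ := h
  have hB : B = A * (A⁻¹ * B) := by group
  refine evalC_injective fun v => ?_
  rw [hB, Matrix.SpecialLinearGroup.coe_mul, act_mul, evalC_act (A⁻¹ * B).1]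
  have e : diagL (A⁻¹ * B).1 v = (r • v.1, r • v.2) := by
    have : ∀ x : Fin 2 → ℂ, (A⁻¹ * B).1 *ᵥ x = r • x := fun x => by
      rw [← hrA]
      ext j
      simp [Matrix.scalar_apply, Matrix.mulVec_diagonal]
    rw [diagL_apply, this, this]
  rw [e, (hf.comp_act A.1).scaling, ← mul_pow]
  have hr2 : r * r = 1 := by simpa [sq] using hr
  rw [hr2, one_pow, one_mul]

/-- The substitution of an element of `PSL(2, ℂ)`, well defined on forms of bidegree `(m, m)`. -/
def pact (g : PSL2) : BiPoly →ₐ[ℂ] BiPoly := act (Quotient.out g).1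

lemma BiForm.pact_mk {f : BiPoly} {m : ℕ} (hf : BiForm f m)
    (A : Matrix.SpecialLinearGroup (Fin 2) ℂ) : pact (QuotientGroup.mk A) f = act A.1 f :=
  hf.act_eq_of_mk_eq (Quotient.out_eq _)

/-- Substitution is a right action; the signs of the chosen lifts disappear because the total degree
`2 * m` is even. -/
lemma BiForm.pact_mul {f : BiPoly} {m : ℕ} (hf : BiForm f m) (g h : PSL2) :
    pact (g * h) f = pact h (pact g f) := by
  induction g using QuotientGroup.induction_on with | _ A =>
  induction h using QuotientGroup.induction_on with | _ B =>
  rw [← QuotientGroup.mk_mul, hf.pact_mk, hf.pact_mk, (hf.comp_act _).pact_mk,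
    Matrix.SpecialLinearGroup.coe_mul, act_mul]

lemma BiForm.pact_one {f : BiPoly} {m : ℕ} (hf : BiForm f m) : pact 1 f = f := by
  rw [← QuotientGroup.mk_one, hf.pact_mk, Matrix.SpecialLinearGroup.coe_one, act_one]

/-- The character of a semi-invariant form. -/
lemma BiForm.exists_character {f : BiPoly} {m : ℕ} (hf : BiForm f m) (hf0 : f ≠ 0)
    {G : Subgroup PSL2} (h : ∀ g ∈ G, ∃ c, pact g f = C c * f) :
    ∃ χ : G →* ℂ, ∀ g : G, pact g.1 f = C (χ g) * f := by
  choose c hc using fun g : G => h g.1 g.2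
  have huniq : ∀ a b : ℂ, C a * f = C b * f → a = b := fun a b hab =>
    C_injective _ _ (mul_right_cancel₀ hf0 hab)
  have h1 : c 1 = 1 := huniq _ _ (by
    rw [← hc, map_one, one_mul]
    exact hf.pact_one)
  have hmul : ∀ g g', c (g * g') = c g * c g' := fun g g' => huniq _ _ (by
    have hC : pact g'.1 (C (c g)) = C (c g) := (pact g'.1).commutes (c g)
    rw [← hc, Subgroup.coe_mul, hf.pact_mul, hc g, map_mul, hC, hc g', map_mul]
    ring)
  exact ⟨⟨⟨c, h1⟩, hmul⟩, hc⟩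

section Character

variable {f : BiPoly} {k : ℕ} {g : PSL2} {c : ℂ}

/-- At the diagonal fixed point `(x, x)` both weights are `l`: either `l ^ (2 * k) = 1`, or `f`
vanishes there and `l ^ (2 * (k - 1)) = 1`. -/
lemma SmoothEquation.dvd_or_dvd (hs : SmoothEquation (evalC f) k) (hf : BiForm f k) (hk : k ≠ 0)
    (hg : IsRotation g) (hinv : pact g f = f) : orderOf g ∣ k ∨ orderOf g ∣ k - 1 := by
  obtain ⟨A, l, x, rfl, hl, hx, hAx, hAx', hord⟩ := hg.exists_axis
  rw [hf.pact_mk] at hinv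
  have har := area_conjPerp_ne_zero hx
  obtain ⟨j, rfl⟩ := Nat.exists_eq_succ_of_ne_zero hk
  rcases hs.character_at_fixedPoint (c := 1) (by rw [hinv]; simp) hl hl har har hAx hAx' hAx hAx'
    with h | ⟨-, h⟩
  · left
    refine orderOf_dvd_of_pow_eq_one (hord _ ?_)
    rw [h]
    ring
  · right
    refine orderOf_dvd_of_pow_eq_one (hord _ ?_)
    rw [or_self] at h
    refine mul_right_cancel₀ (pow_ne_zero 2 hl) ?_
    rw [h, Nat.succ_sub_one, Nat.succ_eq_add_one]
    ring

/-- At the antidiagonal fixed point the weights `l` and `l⁻¹` cancel, so `c = 1` unless `f` vanishes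
there. In that case `c` is `l ^ 2` or its inverse, and `c ^ 2 = 1` would give `g ^ 2 = 1`. -/
lemma SmoothEquation.character_of_antidiagonal (hs : SmoothEquation (evalC f) k) (hf : BiForm f k)
    (hg : IsRotation g) (hc : pact g f = C c * f) (hc2 : c ^ 2 = 1) (h2 : g ^ 2 ≠ 1) : c = 1 := by
  obtain ⟨A, l, x, rfl, hl, hx, hAx, hAx', hord⟩ := hg.exists_axis
  rw [hf.pact_mk] at hc
  have har := area_conjPerp_ne_zero hx
  have har' : area (conjPerp x) x ≠ 0 := by rw [area_swap]; exact neg_ne_zero.2 har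
  have hone : l ^ k * l⁻¹ ^ k = 1 := by rw [← mul_pow, mul_inv_cancel₀ hl, one_pow]
  have := hs.character_at_fixedPoint hc hl (inv_ne_zero hl) har har' hAx hAx' hAx'
    (by rwa [inv_inv])
  rw [hone] at this
  rcases this with h | ⟨-, h | h⟩
  · exact h
  · refine absurd (hord 2 ?_) h2
    linear_combination (c * l ^ 2 + 1) * h - l ^ 4 * hc2
  · refine absurd (hord 2 ?_) h2
    have h3 : c = l ^ 2 := by
      field_simp at h
      exact h
    rw [← h3, hc2]

/-- The antidiagonal fixed point is off the curve, so `f` is nonzero there, and its weight is 1. -/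
lemma BiForm.character_of_subset_twistorSpace (hf : BiForm f k)
    (hs : SmoothEquation (evalC f) k)
    (hZ : PlatonicCurves.zeroLocus f ⊆ twistorSpace) (hg : IsRotation g)
    (hc : pact g f = C c * f) : c = 1 := by
  obtain ⟨A, l, x, rfl, hl, hx, hAx, hAx', -⟩ := hg.exists_axis
  rw [hf.pact_mk] at hc
  have har := area_conjPerp_ne_zero hx
  have har' : area (conjPerp x) x ≠ 0 := by rw [area_swap]; exact neg_ne_zero.2 har
  have hone : l ^ k * l⁻¹ ^ k = 1 := by rw [← mul_pow, mul_inv_cancel₀ hl, one_pow]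
  have := hs.character_at_fixedPoint hc hl (inv_ne_zero hl) har har' hAx hAx' hAx'
    (by rwa [inv_inv])
  rw [hone] at this
  rcases this with h | ⟨h, -⟩
  · exact h
  · exfalso
    rw [← mem_zeroLocus_mk_iff hf hx (conjPerp_ne_zero hx)] at h
    apply hZ h
    exact (antipode_mk hx).symm

end Character

/-! ### Invariant forms from the diagonal and from rotation axes. -/

/-- The equation of the diagonal. -/
def diagForm : BiPoly := X (Sum.inl 0) * X (Sum.inr 1) - X (Sum.inl 1) * X (Sum.inr 0)

lemma evalC_diagForm (v : Coord) : evalC diagForm v = area v.1 v.2 := by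
  simp [evalC, diagForm, area]

lemma isHomogeneous_X_mul_X (i j : Fin 2 ⊕ Fin 2) :
    (X i * X j : BiPoly).IsHomogeneous (2 * 1) :=
  (isHomogeneous_X ℂ i).mul (isHomogeneous_X ℂ j)

lemma biForm_diagForm : BiForm diagForm 1 := by
  refine ⟨(isHomogeneous_X_mul_X _ _).sub (isHomogeneous_X_mul_X _ _), fun a b v => ?_⟩
  rw [evalC_diagForm, evalC_diagForm, area_smul_left, area_smul_right]
  ring

lemma diagForm_ne_zero : diagForm ≠ 0 := by
  intro h
  have := evalC_diagForm (![1, 0], ![0, 1])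
  rw [h] at this
  simp [evalC, area] at this

lemma pact_diagForm (g : PSL2) : pact g diagForm = diagForm := by
  refine evalC_injective fun v => ?_
  rw [pact, evalC_act, evalC_diagForm, evalC_diagForm, diagL_apply, area_mulVec]

/-- The symmetric form of bidegree `(1, 1)` which vanishes on the diagonal at the fixed points
of `A`. -/
def axisForm (A : Matrix (Fin 2) (Fin 2) ℂ) : BiPoly :=
  C (2 * A 1 0) * (X (Sum.inl 0) * X (Sum.inr 0)) +
    C (A 1 1 - A 0 0) * (X (Sum.inl 0) * X (Sum.inr 1) + X (Sum.inl 1) * X (Sum.inr 0)) -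
    C (2 * A 0 1) * (X (Sum.inl 1) * X (Sum.inr 1))

/-- The form is the polarization of `x ↦ area x (A x)`, whose zeros are the eigenvectors; this
intrinsic expression makes conjugation, inversion and change of lift transparent. -/
lemma evalC_axisForm (A : Matrix (Fin 2) (Fin 2) ℂ) (v : Coord) :
    evalC (axisForm A) v = area v.1 (A *ᵥ v.2) + area v.2 (A *ᵥ v.1) := by
  simp only [evalC, axisForm, map_sub, map_add, map_mul, eval_C, eval_X, Sum.elim_inl,
    Sum.elim_inr, area, Matrix.mulVec, dotProduct, Fin.sum_univ_two]
  ring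

lemma biForm_axisForm (A : Matrix (Fin 2) (Fin 2) ℂ) : BiForm (axisForm A) 1 := by
  refine ⟨?_, fun a b v => ?_⟩
  · exact (((isHomogeneous_X_mul_X _ _).C_mul _).add
      (((isHomogeneous_X_mul_X _ _).add (isHomogeneous_X_mul_X _ _)).C_mul _)).sub
      ((isHomogeneous_X_mul_X _ _).C_mul _)
  · simp only [evalC_axisForm, Matrix.mulVec_smul, area_smul_left, area_smul_right]
    ring

lemma act_axisForm (A K : Matrix.SpecialLinearGroup (Fin 2) ℂ) :
    act K.1 (axisForm A.1) = axisForm (K⁻¹ * A * K).1 := by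
  refine evalC_injective fun v => ?_
  have h : ∀ x, A.1 *ᵥ (K.1 *ᵥ x) = K.1 *ᵥ ((K⁻¹ * A * K).1 *ᵥ x) := fun x => by
    have hAK : A * K = K * (K⁻¹ * A * K) := by group
    rw [Matrix.mulVec_mulVec, Matrix.mulVec_mulVec, ← Matrix.SpecialLinearGroup.coe_mul,
      ← Matrix.SpecialLinearGroup.coe_mul, hAK]
  rw [evalC_act, evalC_axisForm, evalC_axisForm]
  simp only [diagL_apply, h, area_mulVec]

/-- `A` preserves area, so moving `A⁻¹` across it produces `A` and a sign. Hence elements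
conjugating a rotation to its inverse also fix the squared form. -/
lemma axisForm_inv (A : Matrix.SpecialLinearGroup (Fin 2) ℂ) :
    axisForm (A⁻¹).1 = -axisForm A.1 := by
  refine evalC_injective fun v => ?_
  have h : ∀ x, x = A.1 *ᵥ ((A⁻¹).1 *ᵥ x) := fun x => by
    rw [Matrix.mulVec_mulVec, ← Matrix.SpecialLinearGroup.coe_mul, mul_inv_cancel,
      Matrix.SpecialLinearGroup.coe_one, Matrix.one_mulVec]
  have e : evalC (-axisForm A.1) v = -evalC (axisForm A.1) v := map_neg _ _
  rw [e, evalC_axisForm, evalC_axisForm, ← area_mulVec A v.1, ← area_mulVec A v.2, ← h, ← h,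
    area_swap v.2, area_swap v.1]
  ring

lemma axisForm_sq_eq_of_mk_eq {A B : Matrix.SpecialLinearGroup (Fin 2) ℂ}
    (h : (QuotientGroup.mk A : PSL2) = QuotientGroup.mk B) :
    axisForm A.1 ^ 2 = axisForm B.1 ^ 2 := by
  rw [QuotientGroup.eq, Matrix.SpecialLinearGroup.mem_center_iff] at h
  obtain ⟨r, hr, hrA⟩ := h
  have hr2 : r ^ 2 = 1 := by simpa using hr
  have hB : B = A * (A⁻¹ * B) := by group
  have h1 : ∀ x, B.1 *ᵥ x = r • A.1 *ᵥ x := fun x => by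
    rw [hB, Matrix.SpecialLinearGroup.coe_mul, ← Matrix.mulVec_mulVec, ← hrA,
      ← Matrix.mulVec_smul]
    congr 1
    ext j
    simp [Matrix.scalar_apply, Matrix.mulVec_diagonal]
  refine evalC_injective fun v => ?_
  simp only [evalC_pow, evalC_axisForm, h1, area_smul_right]
  linear_combination -(area v.1 (A.1 *ᵥ v.2) + area v.2 (A.1 *ᵥ v.1)) ^ 2 * hr2

/-- The square of the form of an axis depends only on the rotation. -/
def axisSq (g : PSL2) : BiPoly := axisForm (Quotient.out g).1 ^ 2

lemma axisSq_mk (A : Matrix.SpecialLinearGroup (Fin 2) ℂ) :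
    axisSq (QuotientGroup.mk A) = axisForm A.1 ^ 2 :=
  axisForm_sq_eq_of_mk_eq (Quotient.out_eq _)

lemma pact_axisSq (g h : PSL2) : pact h (axisSq g) = axisSq (h⁻¹ * g * h) := by
  induction g using QuotientGroup.induction_on with | _ A =>
  induction h using QuotientGroup.induction_on with | _ K =>
  rw [axisSq_mk, ((biForm_axisForm A.1).pow 2).pact_mk, map_pow, act_axisForm, ← QuotientGroup.mk_inv,
    ← QuotientGroup.mk_mul, ← QuotientGroup.mk_mul, axisSq_mk]

lemma axisSq_inv (g : PSL2) : axisSq g⁻¹ = axisSq g := by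
  induction g using QuotientGroup.induction_on with | _ A =>
  rw [← QuotientGroup.mk_inv, axisSq_mk, axisSq_mk, axisForm_inv, neg_sq]

/-- The restriction to the diagonal. -/
def toDiag : BiPoly →ₐ[ℂ] MvPolynomial (Fin 2) ℂ := aeval (Sum.elim X X)

lemma eval_toDiag (f : BiPoly) (x : Fin 2 → ℂ) : eval x (toDiag f) = evalC f (x, x) := by
  have : (eval x).comp toDiag.toRingHom = eval (Sum.elim x x) := by
    refine MvPolynomial.ringHom_ext (fun c => by simp) fun i => ?_
    rcases i with i | i <;> simp [toDiag]
  exact congrArg (fun φ => φ f) this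

lemma toDiag_diagForm : toDiag diagForm = 0 := by
  refine MvPolynomial.funext fun x => ?_
  rw [eval_toDiag, evalC_diagForm, area_self, map_zero]

/-- If it vanished, every vector would be an eigenvector of `A`, making `A` scalar; the test vectors
`(1, 0)`, `(0, 1)`, `(1, 1)` suffice. -/
lemma toDiag_axisSq_ne_zero {g : PSL2} (hg : g ≠ 1) : toDiag (axisSq g) ≠ 0 := by
  induction g using QuotientGroup.induction_on with | _ A =>
  intro h
  rw [axisSq_mk, map_pow] at h
  have h0 : ∀ x : Fin 2 → ℂ, area x (A.1 *ᵥ x) = 0 := fun x => by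
    have := eval_toDiag (axisForm A.1) x
    rw [eq_zero_of_pow_eq_zero h, evalC_axisForm, map_zero] at this
    dsimp only at this
    linear_combination -this / 2
  have h1 := h0 ![1, 0]
  have h2 := h0 ![0, 1]
  have h3 := h0 ![1, 1]
  simp only [area, Matrix.mulVec, dotProduct, Fin.sum_univ_two, Matrix.cons_val_zero,
    Matrix.cons_val_one, mul_one, mul_zero, add_zero, zero_add, one_mul, zero_mul, sub_zero,
    zero_sub, neg_eq_zero] at h1 h2 h3
  refine hg (mk_eq_one_of_smul (r := A.1 0 0) fun x => ?_)
  ext i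
  fin_cases i
  · simp [Matrix.mulVec, dotProduct, h2]
  · simp only [Fin.mk_one, Matrix.mulVec, dotProduct, Fin.sum_univ_two, Pi.smul_apply, smul_eq_mul]
    linear_combination x 0 * h1 + x 1 * (h3 - h1 + h2)

lemma pact_injective (h : PSL2) : Function.Injective (pact h) := fun p p' hp => by
  rw [← act_inv_act (Quotient.out h) p, ← act_inv_act (Quotient.out h) p']
  exact congrArg _ hp

lemma biForm_prod {ι : Type*} (s : Finset ι) (F : ι → BiPoly) (h : ∀ i ∈ s, BiForm (F i) 1) :
    BiForm (∏ i ∈ s, F i) s.card := by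
  classical
  induction s using Finset.induction_on with
  | empty => simpa using biForm_one
  | insert a s ha ih =>
    rw [Finset.prod_insert ha, Finset.card_insert_of_notMem ha, add_comm]
    exact (h a (Finset.mem_insert_self _ _)).mul
      (ih fun i hi => h i (Finset.mem_insert_of_mem hi))

open Classical in
/-- The product of the forms of the axes conjugate to the axis of `g`. -/
theorem exists_form_of_axes {G : Subgroup PSL2} [Fintype G] {g : G} (hg : g ≠ 1) (K : Finset G)
    (hK : ∀ k ∈ K, k⁻¹ * g * k = g ∨ k⁻¹ * g * k = g⁻¹) :
    ∃ (j : ℕ) (P : BiPoly), BiForm P j ∧ j ≠ 0 ∧ K.card * j ≤ Fintype.card G ∧ toDiag P ≠ 0 ∧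
      ∀ h : G, pact h.1 P ^ 2 = P ^ 2 := by
  let F : G → BiPoly := fun h => axisSq (h⁻¹ * g * h : G).1
  have hF : ∀ h h' : G, pact h'.1 (F h) = F (h * h') := fun h h' => by
    simp only [F]
    rw [pact_axisSq]
    congr 1
    simp only [Subgroup.coe_mul, Subgroup.coe_inv]
    group
  -- Taking the image as a set counts each squared form once. One root is chosen for each element,
  -- so the square of the product is `∏ b ∈ 𝓑, b`, which `G` permutes.
  let 𝓑 : Finset BiPoly := Finset.univ.image F
  have hroot : ∀ b ∈ 𝓑, ∃ r, BiForm r 1 ∧ r ^ 2 = b ∧ toDiag r ≠ 0 := by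
    intro b hb
    obtain ⟨h, -, rfl⟩ := Finset.mem_image.1 hb
    refine ⟨axisForm (Quotient.out (h⁻¹ * g * h : G).1).1, biForm_axisForm _, rfl, fun h0 => ?_⟩
    refine toDiag_axisSq_ne_zero (g := (h⁻¹ * g * h : G).1) (fun h1 => hg ?_) ?_
    · have h2 : h⁻¹ * g * h = 1 := Subtype.ext h1
      have h3 : g = h * (h⁻¹ * g * h) * h⁻¹ := by group
      rw [h3, h2]
      group
    · rw [axisSq, map_pow, h0, zero_pow two_ne_zero]
  choose! r hr1 hr2 hr3 using hroot
  refine ⟨𝓑.card, ∏ b ∈ 𝓑, r b, biForm_prod _ _ hr1, ?_, ?_, ?_, fun h => ?_⟩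
  · exact Finset.card_ne_zero.2 ⟨F 1, Finset.mem_image_of_mem _ (Finset.mem_univ _)⟩
  -- Each fibre of `F` contains a translate of `K`; `K` need not be a subgroup.
  · refine Finset.mul_card_image_le_card Finset.univ K.card fun b hb => ?_
    obtain ⟨h, -, rfl⟩ := Finset.mem_image.1 hb
    refine Finset.card_le_card_of_injOn (fun k => k * h) (fun k hk => ?_)
      fun k _ k' _ hkk => mul_right_cancel hkk
    have h1 : F k = F 1 := by
      simp only [F]
      rcases hK k hk with h1 | h1
      · rw [h1, inv_one, one_mul, mul_one]
      · rw [h1, inv_one, one_mul, mul_one, Subgroup.coe_inv, axisSq_inv]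
    have h2 : F (k * h) = F h := by rw [← hF k h, h1, hF, one_mul]
    exact Finset.mem_coe.2 (Finset.mem_filter.2 ⟨Finset.mem_univ _, h2⟩)
  · rw [map_prod, Finset.prod_ne_zero_iff]
    exact hr3
  · rw [← map_pow, ← Finset.prod_pow, Finset.prod_congr rfl hr2, map_prod]
    refine Finset.prod_nbij (pact h.1) (fun b hb => ?_) (pact_injective _).injOn (fun b hb => ?_)
      fun b _ => rfl
    · obtain ⟨h', -, rfl⟩ := Finset.mem_image.1 hb
      rw [hF]
      exact Finset.mem_image_of_mem _ (Finset.mem_univ _)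
    · obtain ⟨h', -, rfl⟩ := Finset.mem_image.1 (Finset.mem_coe.1 hb)
      exact ⟨F (h' * h⁻¹), Finset.mem_coe.2 (Finset.mem_image_of_mem _ (Finset.mem_univ _)), by
        rw [hF, inv_mul_cancel_right]⟩

/-! ### The upper bound for the degree. -/

/-- There is no invariant form of bidegree `(j, j)` with `1 ≤ j ≤ k - 2` which does not vanish on
the diagonal. -/
theorem TorusMap.false_of_invariant {G : Subgroup PSL2} [Finite G] {f P : BiPoly} {m j : ℕ}
    {L : PeriodPair} {q : Coord → ℂ ⧸ L.lattice} (hf : BiForm f (m + 2)) (hf0 : f ≠ 0)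
    (hsq : Squarefree f) (hs : SmoothEquation (evalC f) (m + 2))
    (hq : TorusMap (evalC f) L (fun g : G => Quotient.out g.1) q)
    (hfG : ∀ g : G, pact g.1 f = f) (hP : BiForm P j) (hj : j ≠ 0) (hjm : j ≤ m)
    (hPG : ∀ g : G, pact g.1 P = P) (hPd : toDiag P ≠ 0) : False := by
  have hinv : ∀ p : BiPoly, (∀ g : G, pact g.1 p = p) → ∀ (g : G) (v : Coord),
      evalC p (diagL (Quotient.out g.1).1 v) = evalC p v := fun p hp g v => by
    rw [← evalC_act]
    exact congrArg (fun p => evalC p v) (hp g)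
  have h₁ : BiForm (P * diagForm ^ (m - j)) m := by
    have := hP.mul (biForm_diagForm.pow (m - j))
    rwa [one_mul, Nat.add_sub_cancel' hjm] at this
  have h₂ : BiForm (diagForm ^ m) m := by
    have := biForm_diagForm.pow m
    rwa [one_mul] at this
  obtain ⟨a, b, hab, h⟩ := exists_linear_relation hs hq (hinv f hfG) h₁.scaling
    (analyticAt_evalC _) (hinv _ fun g => by rw [map_mul, map_pow, hPG, pact_diagForm]) h₂.scaling
    (analyticAt_evalC _) (hinv _ fun g => by rw [map_pow, pact_diagForm])
  -- The relation on the curve has bidegree `(m, m)`, below that of `f`, so it is an identity of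
  -- polynomials.
  have hz := hf.eq_zero_of_vanishing ((h₁.C_mul a).add (h₂.C_mul b)) hf0 hsq (by omega) (by omega)
    fun v hv => by
      rw [evalC_add, evalC_mul (C a), evalC_mul (C b), evalC_C, evalC_C]
      exact h v hv
  have hfac : diagForm ^ (m - j) * (C a * P + C b * diagForm ^ j) = 0 := by
    rw [← hz]
    have : diagForm ^ m = diagForm ^ (m - j) * diagForm ^ j := by
      rw [← pow_add, Nat.sub_add_cancel hjm]
    rw [this]
    ring
  have hsum := (mul_eq_zero.1 hfac).resolve_left (pow_ne_zero _ diagForm_ne_zero)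
  -- Since `j ≠ 0`, restriction to the diagonal kills the power of `diagForm` and leaves `a` times
  -- `toDiag P`.
  have ha : a = 0 := by
    have hd := congrArg toDiag hsum
    rw [map_add, map_mul, map_mul, map_pow, toDiag_diagForm, zero_pow hj, mul_zero, add_zero,
      map_zero] at hd
    have := (mul_eq_zero.1 hd).resolve_right hPd
    have hC : toDiag (C a) = C a := toDiag.commutes a
    rw [hC] at this
    exact C_eq_zero.1 this
  rw [ha, map_zero, zero_mul, zero_add] at hsum
  have hb := C_eq_zero.1 ((mul_eq_zero.1 hsum).resolve_right (pow_ne_zero _ diagForm_ne_zero))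
  exact hab.elim (fun h => h ha) fun h => h hb

/-! ### Characters and explicit elements of the alternating and symmetric groups. -/

section Permutations

lemma eq_one_of_sq_of_cube {c : ℂ} (h2 : c ^ 2 = 1) (h3 : c ^ 3 = 1) : c = 1 := by
  linear_combination h3 - c * h2

/-- Three-cycles generate, and a character value on them is a cube root of 1. In `A₄` they are not
conjugate to their inverses, so the condition on squares cannot be dropped. -/
lemma alternatingGroup_hom_eq_one {n : ℕ} (χ : alternatingGroup (Fin n) →* ℂ)
    (h : ∀ g : alternatingGroup (Fin n), Perm.IsThreeCycle (g : Perm (Fin n)) → χ g ^ 2 = 1) :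
    χ = 1 := by
  refine MonoidHom.eq_of_eqOn_dense alternatingGroup.closure_isThreeCycles_eq_top fun g hg => ?_
  have hg' : Perm.IsThreeCycle (g : Perm (Fin n)) := hg
  have h3 : g ^ 3 = 1 := by
    rw [← hg'.orderOf, Subgroup.orderOf_coe]
    exact pow_orderOf_eq_one g
  refine eq_one_of_sq_of_cube (h g hg) ?_
  rw [← map_pow, h3, map_one]

lemma sq_eq_one_of_isConj_inv {H : Type*} [Group H] (χ : H →* ℂ) {g : H} (h : IsConj g g⁻¹) :
    χ g ^ 2 = 1 := by
  obtain ⟨c, hc⟩ := isConj_iff.1 h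
  have h1 : χ g⁻¹ = χ g := by
    rw [← hc, map_mul, map_mul, mul_right_comm, ← map_mul, mul_inv_cancel, map_one, one_mul]
  rw [sq]
  nth_rw 2 [← h1]
  rw [← map_mul, mul_inv_cancel, map_one]

lemma alternatingGroup_five_hom_eq_one (χ : alternatingGroup (Fin 5) →* ℂ) : χ = 1 :=
  alternatingGroup_hom_eq_one χ fun g hg => sq_eq_one_of_isConj_inv χ
    (alternatingGroup.isThreeCycle_isConj (by simp) hg (by simpa using hg))

lemma perm_hom_eq_one_of_mem_alternatingGroup {n : ℕ} (χ : Perm (Fin n) →* ℂ) {σ : Perm (Fin n)}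
    (hσ : σ ∈ alternatingGroup (Fin n)) : χ σ = 1 := by
  have h := alternatingGroup_hom_eq_one (χ.comp (alternatingGroup (Fin n)).subtype) fun g _ =>
    sq_eq_one_of_isConj_inv χ (Perm.isConj_iff_cycleType_eq.2 (by rw [Perm.cycleType_inv]))
  exact DFunLike.congr_fun h ⟨σ, hσ⟩

lemma exists_orderOf_eq_three_alternatingGroup {n : ℕ} (hn : 3 ≤ n) :
    ∃ g : alternatingGroup (Fin n), orderOf g = 3 := by
  have h : Perm.IsThreeCycle (swap (⟨0, by omega⟩ : Fin n) ⟨1, by omega⟩ *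
      swap (⟨0, by omega⟩ : Fin n) ⟨2, by omega⟩) :=
    Perm.isThreeCycle_swap_mul_swap_same (by simp) (by simp) (by simp)
  exact ⟨⟨_, h.mem_alternatingGroup⟩, by rw [← Subgroup.orderOf_coe]; exact h.orderOf⟩

lemma finRotate_five_mem : finRotate 5 ∈ alternatingGroup (Fin 5) :=
  Perm.mem_alternatingGroup.2 (by decide)

lemma orderOf_finRotate_five : orderOf (⟨finRotate 5, finRotate_five_mem⟩ :
    alternatingGroup (Fin 5)) = 5 := by
  have : Fact (Nat.Prime 5) := ⟨by norm_num⟩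
  exact orderOf_eq_prime (by decide) (by decide)

lemma orderOf_finRotate_four : orderOf (finRotate 4) = 4 :=
  orderOf_eq_prime_pow (p := 2) (n := 1) (by decide) (by decide)

lemma swap_mul_swap_mem_alternatingGroup {n : ℕ} {a b c d : Fin n} (hab : a ≠ b) (hcd : c ≠ d) :
    swap a b * swap c d ∈ alternatingGroup (Fin n) := by
  simp [Perm.mem_alternatingGroup, Perm.sign_swap hab, Perm.sign_swap hcd]

/-- Three elements of the Klein four-group; the resulting bound `j ≤ 4` is not sharp but is enough.
-/
lemma exists_axis_alternatingGroup_four :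
    ∃ (g : alternatingGroup (Fin 4)) (K : Finset (alternatingGroup (Fin 4))), g ≠ 1 ∧
      K.card = 3 ∧ ∀ k ∈ K, k⁻¹ * g * k = g ∨ k⁻¹ * g * k = g⁻¹ := by
  let a : alternatingGroup (Fin 4) :=
    ⟨swap 0 1 * swap 2 3, swap_mul_swap_mem_alternatingGroup (by decide) (by decide)⟩
  let b : alternatingGroup (Fin 4) :=
    ⟨swap 0 2 * swap 1 3, swap_mul_swap_mem_alternatingGroup (by decide) (by decide)⟩
  exact ⟨a, {1, a, b}, by decide, by decide, by decide⟩

/-- `K` is the dihedral group of order 8 of a square, which centralizes its half turn. -/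
lemma exists_axis_perm_four :
    ∃ (g : Perm (Fin 4)) (K : Finset (Perm (Fin 4))), g ≠ 1 ∧
      K.card = 8 ∧ ∀ k ∈ K, k⁻¹ * g * k = g ∨ k⁻¹ * g * k = g⁻¹ :=
  ⟨finRotate 4 ^ 2, (Finset.univ : Finset (Fin 4 × Fin 2)).image
    fun p => finRotate 4 ^ p.1.1 * swap 0 2 ^ p.2.1, by decide, by decide, by decide⟩

-- `K` is the dihedral group of order 10 of a pentagon, whose reflections invert the 5-cycle.
set_option maxRecDepth 4000 in
lemma exists_axis_alternatingGroup_five :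
    ∃ (g : alternatingGroup (Fin 5)) (K : Finset (alternatingGroup (Fin 5))), g ≠ 1 ∧
      K.card = 10 ∧ ∀ k ∈ K, k⁻¹ * g * k = g ∨ k⁻¹ * g * k = g⁻¹ := by
  let a : alternatingGroup (Fin 5) := ⟨finRotate 5, finRotate_five_mem⟩
  let b : alternatingGroup (Fin 5) :=
    ⟨swap 0 4 * swap 1 3, swap_mul_swap_mem_alternatingGroup (by decide) (by decide)⟩
  exact ⟨a, (Finset.univ : Finset (Fin 5 × Fin 2)).image fun p => a ^ p.1.1 * b ^ p.2.1,
    by decide, by decide, by decide⟩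

end Permutations

/-! ### Determination of the degrees. -/

section Classification

/-- A bihomogeneous equation of a smooth curve whose quotient by `G` is an elliptic curve. -/
structure EllipticModel (G : Subgroup PSL2) (k : ℕ) (f : BiPoly) : Prop where
  form : BiForm f k
  ne_zero : f ≠ 0
  squarefree : Squarefree f
  smooth : SmoothEquation (evalC f) k
  torus : ∃ (L : PeriodPair) (q : Coord → ℂ ⧸ L.lattice),
    TorusMap (evalC f) L (fun g : G => Quotient.out g.1) q

variable {G : Subgroup PSL2} {k : ℕ} {f : BiPoly}

lemma IsSmoothCurve.exists_ellipticModel {S : Set (P1 × P1)} (hS : IsSmoothCurve k S)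
    (hE : HasEllipticQuotient G S) : ∃ f, EllipticModel G k f ∧ S = zeroLocus f := by
  obtain ⟨f, hf, hSf, hs⟩ := hS
  have hs' : ∀ v : Coord, v.1 ≠ 0 → v.2 ≠ 0 → evalC f v = 0 → ∃ i, evalC (pderiv i f) v ≠ 0 :=
    fun v h1 h2 h => hs v.1 v.2 h1 h2 h
  obtain ⟨hf0, hsq⟩ := squarefree_of_smooth hs'
  exact ⟨f, ⟨hf.biForm, hf0, hsq,
    ⟨analyticAt_evalC f, hf.biForm.scaling, fun v hv =>
      (hs' v hv.1 hv.2.1 hv.2.2).elim fun _ hi => fderiv_evalC_ne_zero hi⟩,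
    exists_torusMap hf.biForm hSf hE⟩, hSf⟩

lemma EllipticModel.two_le [Finite G] (h : EllipticModel G k f) : 2 ≤ k := by
  obtain ⟨L, q, hq⟩ := h.torus
  by_contra! hk
  interval_cases k
  · obtain ⟨v, hv, -⟩ := hq.surj 0
    refine h.smooth.smooth v hv ?_
    -- In degree 0 the scaling law at the scalar 0 reads `0 ^ 0 = 1`, so `f` is constant; its
    -- differential then vanishes at the zero provided by surjectivity.
    have hc : evalC f = fun _ => evalC f 0 := by
      ext w
      simpa [← Prod.zero_eq_mk] using (h.smooth.scaling 0 0 w).symm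
    rw [hc]
    simp
  · exact hq.false_of_degree_one h.smooth

lemma EllipticModel.exists_character [Finite G] (h : EllipticModel G k f)
    (hinv : ∀ g ∈ G, ∀ p ∈ zeroLocus f, g • p ∈ zeroLocus f) :
    ∃ χ : G →* ℂ, ∀ g : G, pact g.1 f = C (χ g) * f := by
  refine h.form.exists_character h.ne_zero fun g hg => ?_
  refine exists_act_eq_C_mul h.form h.ne_zero h.squarefree (by have := h.two_le; omega) rfl
    fun p hp => ?_
  have hout : (QuotientGroup.mk (Quotient.out g) : PSL2) = g := Quotient.out_eq g
  rw [hout]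
  exact hinv g hg p hp

lemma EllipticModel.dvd_or_dvd [Finite G] (h : EllipticModel G k f)
    (hG : ∀ g ∈ G, IsRotation g) (hfG : ∀ g : G, pact g.1 f = f) {H : Type*} [Group H]
    (φ : G ≃* H) {σ : H} {n : ℕ} (hσ : orderOf σ = n) : n ∣ k ∨ n ∣ k - 1 := by
  have ho : orderOf (φ.symm σ).1 = n := by
    rw [Subgroup.orderOf_coe, MulEquiv.orderOf_eq, hσ]
  have := h.smooth.dvd_or_dvd h.form (by have := h.two_le; omega) (hG _ (φ.symm σ).2)
    (hfG (φ.symm σ))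
  rwa [ho] at this

lemma EllipticModel.lt_of_invariant [Finite G] (h : EllipticModel G k f)
    (hfG : ∀ g : G, pact g.1 f = f) {P : BiPoly} {j : ℕ} (hP : BiForm P j) (hj : j ≠ 0)
    (hPG : ∀ g : G, pact g.1 P = P) (hPd : toDiag P ≠ 0) : k < j + 2 := by
  by_contra! hk
  obtain ⟨m, rfl⟩ := Nat.exists_eq_add_of_le' (le_trans (Nat.le_add_left 2 j) hk)
  obtain ⟨L, q, hq⟩ := h.torus
  exact hq.false_of_invariant h.form h.ne_zero h.squarefree h.smooth hfG hP hj (by omega) hPG hPd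

/-- The product of the forms of the axes conjugate to the axis of an element, whose stabilizer
contains `K`. -/
lemma exists_form_of_mulEquiv {H : Type*} [Group H] [Fintype H] (φ : G ≃* H) {σ : H} (hσ : σ ≠ 1)
    {K : Finset H} (hK : ∀ τ ∈ K, τ⁻¹ * σ * τ = σ ∨ τ⁻¹ * σ * τ = σ⁻¹) :
    ∃ (j : ℕ) (P : BiPoly), BiForm P j ∧ j ≠ 0 ∧ K.card * j ≤ Fintype.card H ∧ toDiag P ≠ 0 ∧
      ∀ g : G, pact g.1 P ^ 2 = P ^ 2 := by
  let _ : Fintype G := Fintype.ofEquiv H φ.symm.toEquiv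
  obtain ⟨j, P, hP, hj, hle, hd, hG⟩ := exists_form_of_axes (g := φ.symm σ) (by simpa using hσ)
    (K.map φ.symm.toEquiv.toEmbedding) (by
      intro τ hτ
      obtain ⟨ρ, hρ, rfl⟩ := Finset.mem_map.1 hτ
      refine (hK ρ hρ).imp (fun h => ?_) fun h => ?_
      · simpa using congrArg φ.symm h
      · simpa using congrArg φ.symm h)
  rw [Finset.card_map, Fintype.card_congr φ.toEquiv] at hle
  exact ⟨j, P, hP, hj, hle, hd, hG⟩

/-- The form is invariant up to a sign character, and alternating groups have no nontrivial one. -/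
lemma BiForm.pact_eq_of_sq_eq {P : BiPoly} {j n : ℕ} (hP : BiForm P j) (hP0 : P ≠ 0)
    (hPG : ∀ g : G, pact g.1 P ^ 2 = P ^ 2) (φ : G ≃* alternatingGroup (Fin n)) (g : G) :
    pact g.1 P = P := by
  have hsign : ∀ g : G, ∃ c : ℂ, c ^ 2 = 1 ∧ pact g.1 P = C c * P := fun g => by
    rcases sq_eq_sq_iff_eq_or_eq_neg.1 (hPG g) with h | h
    · exact ⟨1, by norm_num, by rw [h, C_1, one_mul]⟩
    · exact ⟨-1, by norm_num, by rw [h, C_neg, C_1, neg_one_mul]⟩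
  obtain ⟨χ, hχ⟩ := hP.exists_character hP0 (G := G) fun g hg =>
    (hsign ⟨g, hg⟩).imp fun c hc => hc.2
  have h1 : χ.comp φ.symm.toMonoidHom = 1 := alternatingGroup_hom_eq_one _ fun σ _ => by
    obtain ⟨c, hc, h⟩ := hsign (φ.symm σ)
    rw [hχ] at h
    have : χ (φ.symm σ) = c := C_injective _ _ (mul_right_cancel₀ hP0 h)
    simpa [this] using hc
  have hg : χ g = 1 := by simpa using DFunLike.congr_fun h1 (φ g)
  rw [hχ, hg, C_1, one_mul]

theorem EllipticModel.degree_of_alternatingGroup_four (h : EllipticModel G k f)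
    (hG : ∀ g ∈ G, IsRotation g) (hinv : ∀ g ∈ G, ∀ p ∈ zeroLocus f, g • p ∈ zeroLocus f)
    (φ : G ≃* alternatingGroup (Fin 4)) (hZ : zeroLocus f ⊆ twistorSpace) : k = 3 ∨ k = 4 := by
  have : Finite G := Finite.of_equiv _ φ.symm.toEquiv
  obtain ⟨χ, hχ⟩ := h.exists_character hinv
  have hfG : ∀ g : G, pact g.1 f = f := fun g => by
    rw [hχ, h.form.character_of_subset_twistorSpace h.smooth hZ (hG g g.2) (hχ g), C_1, one_mul]
  obtain ⟨σ, hσ⟩ := exists_orderOf_eq_three_alternatingGroup (n := 4) (by norm_num)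
  have h3 := h.dvd_or_dvd hG hfG φ hσ
  obtain ⟨a, K, ha, hK, haK⟩ := exists_axis_alternatingGroup_four
  obtain ⟨j, P, hP, hj, hle, hd, hPG⟩ := exists_form_of_mulEquiv φ ha haK
  have hlt := h.lt_of_invariant hfG hP hj
    (hP.pact_eq_of_sq_eq (fun h0 => hd (by rw [h0, map_zero])) hPG φ) hd
  have hcard : Fintype.card (alternatingGroup (Fin 4)) = 12 := by
    rw [← Nat.card_eq_fintype_card, nat_card_alternatingGroup]; simp [Nat.factorial]
  have := h.two_le
  rw [hK, hcard] at hle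
  -- `j ≤ 4` gives `2 ≤ k ≤ 5`, and modulo 3 the degree is 0 or 1.
  omega

theorem EllipticModel.degree_of_alternatingGroup_five (h : EllipticModel G k f)
    (hG : ∀ g ∈ G, IsRotation g) (hinv : ∀ g ∈ G, ∀ p ∈ zeroLocus f, g • p ∈ zeroLocus f)
    (φ : G ≃* alternatingGroup (Fin 5)) : k = 6 := by
  have : Finite G := Finite.of_equiv _ φ.symm.toEquiv
  obtain ⟨χ, hχ⟩ := h.exists_character hinv
  have hfG : ∀ g : G, pact g.1 f = f := fun g => by
    have h1 : χ g = 1 := by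
      simpa using DFunLike.congr_fun
        (alternatingGroup_five_hom_eq_one (χ.comp φ.symm.toMonoidHom)) (φ g)
    rw [hχ, h1, C_1, one_mul]
  obtain ⟨σ, hσ⟩ := exists_orderOf_eq_three_alternatingGroup (n := 5) (by norm_num)
  have h3 := h.dvd_or_dvd hG hfG φ hσ
  have h5 := h.dvd_or_dvd hG hfG φ orderOf_finRotate_five
  obtain ⟨a, K, ha, hK, haK⟩ := exists_axis_alternatingGroup_five
  obtain ⟨j, P, hP, hj, hle, hd, hPG⟩ := exists_form_of_mulEquiv φ ha haK
  have hlt := h.lt_of_invariant hfG hP hj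
    (hP.pact_eq_of_sq_eq (fun h0 => hd (by rw [h0, map_zero])) hPG φ) hd
  have hcard : Fintype.card (alternatingGroup (Fin 5)) = 60 := by
    rw [← Nat.card_eq_fintype_card, nat_card_alternatingGroup]; simp [Nat.factorial]
  have := h.two_le
  rw [hK, hcard] at hle
  -- `j ≤ 6` gives `k ≤ 7`; modulo 3 and modulo 5 the degree is 0 or 1, which leaves 6.
  omega

theorem EllipticModel.degree_of_perm_four (h : EllipticModel G k f)
    (hG : ∀ g ∈ G, IsRotation g) (hinv : ∀ g ∈ G, ∀ p ∈ zeroLocus f, g • p ∈ zeroLocus f)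
    (φ : G ≃* Perm (Fin 4)) : k = 4 := by
  have : Finite G := Finite.of_equiv _ φ.symm.toEquiv
  obtain ⟨χ, hχ⟩ := h.exists_character hinv
  set ψ : Perm (Fin 4) →* ℂ := χ.comp φ.symm.toMonoidHom with hψ
  have heven : ∀ σ ∈ alternatingGroup (Fin 4), ψ σ = 1 := fun σ hσ =>
    perm_hom_eq_one_of_mem_alternatingGroup ψ hσ
  have hodd : Perm.sign (finRotate 4) = -1 := by decide
  -- A 4-cycle is odd, its square is even and nontrivial: the antidiagonal argument applies and
  -- rules out the sign character.
  have hrot : ψ (finRotate 4) = 1 := by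
    refine h.smooth.character_of_antidiagonal h.form (hG _ (φ.symm (finRotate 4)).2)
      (hχ (φ.symm (finRotate 4))) ?_ fun h1 => ?_
    · rw [← map_pow]
      exact heven _ (Perm.mem_alternatingGroup.2 (by decide))
    · have h2 : φ.symm (finRotate 4) ^ 2 = 1 := Subtype.ext h1
      rw [← map_pow, map_eq_one_iff _ φ.symm.injective] at h2
      exact absurd h2 (by decide)
  have hψ1 : ∀ σ, ψ σ = 1 := fun σ => by
    rcases Int.units_eq_one_or (Perm.sign σ) with hσ | hσ
    · exact heven σ (Perm.mem_alternatingGroup.2 hσ)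
    · rw [← inv_mul_cancel_right σ (finRotate 4), map_mul, hrot, mul_one]
      exact heven _ (Perm.mem_alternatingGroup.2 (by simp [hσ, hodd]))
  have hfG : ∀ g : G, pact g.1 f = f := fun g => by
    have h1 : χ g = 1 := by simpa [hψ] using hψ1 (φ g)
    rw [hχ, h1, C_1, one_mul]
  obtain ⟨σ, hσ⟩ := exists_orderOf_eq_three_alternatingGroup (n := 4) (by norm_num)
  have h3 := h.dvd_or_dvd hG hfG φ ((Subgroup.orderOf_coe σ).trans hσ)
  have h4 := h.dvd_or_dvd hG hfG φ orderOf_finRotate_four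
  obtain ⟨a, K, ha, hK, haK⟩ := exists_axis_perm_four
  obtain ⟨j, P, hP, hj, hle, hd, hPG⟩ := exists_form_of_mulEquiv φ ha haK
  -- `P` may change sign under odd permutations, so its square, of bidegree `(2 * j, 2 * j)`, is
  -- used.
  have hlt := h.lt_of_invariant hfG (hP.pow 2) (by omega)
    (fun g => by rw [map_pow, hPG]) (by rw [map_pow]; exact pow_ne_zero 2 hd)
  have hcard : Fintype.card (Perm (Fin 4)) = 24 := by simp [Fintype.card_perm, Nat.factorial]
  have := h.two_le
  rw [hK, hcard] at hle
  -- `j ≤ 3` gives `k ≤ 7`; modulo 3 and modulo 4 the degree is 0 or 1, which leaves 4.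
  omega

end Classification

end PlatonicCurves

end

theorem proposition5p2 (k : ℕ)
    (S : Set (PlatonicCurves.P1 × PlatonicCurves.P1))
    (hS : PlatonicCurves.IsSmoothCurve k S)
    (G : Subgroup PlatonicCurves.PSL2)
    (hG : ∀ g ∈ G, PlatonicCurves.IsRotation g)
    (hinv : ∀ g ∈ G, ∀ p ∈ S, g • p ∈ S)
    (hE : PlatonicCurves.HasEllipticQuotient G S) :
    (Nonempty (G ≃* alternatingGroup (Fin 4)) → S ⊆ PlatonicCurves.twistorSpace →
      k = 3 ∨ k = 4) ∧
    (Nonempty (G ≃* Equiv.Perm (Fin 4)) → k = 4) ∧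
    (Nonempty (G ≃* alternatingGroup (Fin 5)) → k = 6) := by
  obtain ⟨f, hf, rfl⟩ := hS.exists_ellipticModel hE
  exact ⟨fun ⟨φ⟩ hZ => hf.degree_of_alternatingGroup_four hG hinv φ hZ,
    fun ⟨φ⟩ => hf.degree_of_perm_four hG hinv φ,
    fun ⟨φ⟩ => hf.degree_of_alternatingGroup_five hG hinv φ⟩
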